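/- Let $\mathcal{K}=\{\mathbf{x}\in\mathbb{R}^d : \mathbf{A}_1\mathbf{x}=\mathbf{b}_1,\ \mathbf{A}_2\mathbf{x}\le\mathbf{b}_2\}$ be a nonempty compact polytope with set of vertices $\mathcal{V}$, and let $f$ be a real function that is differentiable at the points of $\mathcal{K}$, convex on $\mathcal{K}$ and $\beta$-smooth over $\mathcal{K}$, i.e. $f(\mathbf{y})\le f(\mathbf{x})+(\mathbf{y}-\mathbf{x})^\top\nabla f(\mathbf{x})+\frac{\beta}{2}\|\mathbf{y}-\mathbf{x}\|^2$ for all $\mathbf{x},\mathbf{y}\in\mathcal{K}$, where $\beta\ge 0$ and $\|\cdot\|$ is the Euclidean norm. Put $f^*=\min_{\mathcal{K}}f$ and $\mathcal{X}^*=\arg\min_{\mathcal{K}}f$, and suppose that quadratic growth holds with parameter $\alpha>0$: $\mathrm{dist}(\mathbf{x},\mathcal{X}^*)^2\le\frac{2}{\alpha}(f(\mathbf{x})-f^*)$ for all $\mathbf{x}\in\mathcal{K}$. For a face $\mathcal{F}$ of $\mathcal{K}$ let $\dim\mathcal{F}$ be $d$ minus the dimension of the span of the rows of $\mathbf{A}_1$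 together with those rows of $\mathbf{A}_2$ whose constraint is tight at every point of $\mathcal{F}$. Let $\mathcal{F}^*$ be the lowest-dimensional face of $\mathcal{K}$ containing $\mathcal{X}^*$, and $D_{\mathcal{F}^*}$ its Euclidean diameter. Let $\mathbf{A}_2^*,\mathbf{b}_2^*$ consist of the rows of $\mathbf{A}_2,\mathbf{b}_2$ whose constraint is tight at some points of $\mathcal{F}^*$ but not at all of them. Let $\psi$ be the maximum spectral norm of a $\dim\mathcal{F}^*\times d$ matrix whose rows are linearly independent rows of $\mathbf{A}_2^*$, let $\xi$ be the minimum of all positive values $\mathbf{b}_2^*(i)-\mathbf{A}_2^*(i)^\top\mathbf{v}$ over $\mathbf{v}\in\mathcal{V}\cap\mathcal{F}^*$ and all $i$, and let $\mu=\psi/\xi$ and $\kappa=2\mu^2\dim\mathcal{F}^*/\alpha$ (with $\kappa=0$ if $\dim\mathcal{F}^*=0$). Suppose that $\delta$-strict complementarity holds with some $\delta>0$: for all $\mathbf{x}^*\in\mathcal{X}^*$ and $\mathbf{v}\in\mathcal{V}$, if $\mathbf{v}\notin\mathcal{F}^*$ then $(\mathbf{v}-\mathbf{x}^*)^\top\nabla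 f(\mathbf{x}^*)\ge\delta$, and if $\mathbf{v}\in\mathcal{F}^*$ then $(\mathbf{v}-\mathbf{x}^*)^\top\nabla f(\mathbf{x}^*)=0$. Consider the following algorithm with parameters $\rho_t\in[0,1]$, $t\ge1$. Start at some vertex $\mathbf{x}_1\in\mathcal{V}$. In iteration $t\ge1$, take a decomposition of $\mathbf{x}_t$ as a convex combination of vertices $\mathbf{v}_1,\dots,\mathbf{v}_k$, let $\mathbf{v}_{k+1}\in\arg\min_{\mathbf{u}\in\mathcal{V}}\ \mathbf{u}^\top\nabla f(\mathbf{x}_t)+\beta\rho_t\|\mathbf{u}-\mathbf{x}_t\|^2$, and let $\mathbf{x}_{t+1}$ be a minimizer over $\mathrm{conv}(\mathbf{v}_1,\dots,\mathbf{v}_{k+1})$ of either $\mathbf{x}\mapsto\mathbf{x}^\top\nabla f(\mathbf{x}_t)+\frac{\beta}{2}\|\mathbf{x}-\mathbf{x}_t\|^2$ (Option 1) or $f$ (Option 2, fully corrective). Let $C\ge f(\mathbf{x}_1)-f^*$ and $M_1\ge\max\{\frac{4\beta}{\alpha}+8\beta D_{\mathcal{F}^*}^2\max\{2\kappa,\delta^{-1}\},\frac12\}$.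 Then the following holds, whatever vertices, decompositions, minimizers and options the algorithm picks. (1) If $\rho_t=\frac{1}{2M_1}\min\Big\{\sqrt{2\max\{2\kappa,\delta^{-1}\}\,C\exp\big(-\tfrac{t-1}{4M_1}\big)},\,1\Big\}$ for all $t\ge1$, then $$f(\mathbf{x}_t)-f^*\le C\exp\Big(-\frac{t-1}{4M_1}\Big)\qquad\text{for all } t\ge 1.$$ (2) Suppose moreover that $2\kappa\le\delta^{-1}$ and $\dim\mathcal{F}^*>0$. Let $M_2\ge\max\{\frac{4\beta}{\alpha}+16\beta\kappa D_{\mathcal{F}^*}^2,\frac12\}$ and let $\tau\ge1$ be an integer with $\tau\ge4M_1\log\big(\frac{C}{\delta^2\kappa}\big)+1$ (when $C=0$ every $\tau\ge1$ is allowed). If $\rho_t$ is as in (1) for $t<\tau$ and $\rho_t=\frac{1}{2M_2}\min\big\{2\delta\kappa\exp\big(-\tfrac{t-\tau}{8M_2}\big),1\big\}$ for $t\ge\tau$, then $$f(\mathbf{x}_t)-f^*\le\delta^2\kappa\exp\Big(-\frac{t-\tau}{4M_2}\Big)\qquad\text{for all } t\ge\tau.$$ -/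

import Mathlib

open scoped Matrix

noncomputable section

namespace NEPFrankWolfe

/-- The set of minimizers of `g` over `s`. -/
def argminSet {E : Type*} (g : E → ℝ) (s : Set E) : Set E :=
  {x | x ∈ s ∧ ∀ y ∈ s, g x ≤ g y}

/-- The infimum of `f` over `K` (a minimum when `f` is continuous and `K` is nonempty and
compact). -/
def optVal {E : Type*} (f : E → ℝ) (K : Set E) : ℝ := sInf (f '' K)

/-- `f` is `β`-smooth over `K`: it is differentiable at the points of `K` and satisfies the
quadratic upper bound there. On a convex set this follows from (and for convex functions on the
whole space it is equivalent to) `β`-Lipschitz continuity of the gradient. -/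
def IsSmoothOn {d : ℕ} (f : EuclideanSpace ℝ (Fin d) → ℝ) (β : ℝ)
    (K : Set (EuclideanSpace ℝ (Fin d))) : Prop :=
  (∀ x ∈ K, DifferentiableAt ℝ f x) ∧
    ∀ x ∈ K, ∀ y ∈ K,
      f y ≤ f x + inner ℝ (y - x) (gradient f x) + β / 2 * ‖y - x‖ ^ 2

/-- Quadratic growth of `f` over `K` with parameter `α`. -/
def QuadraticGrowth {d : ℕ} (f : EuclideanSpace ℝ (Fin d) → ℝ) (α : ℝ)
    (K : Set (EuclideanSpace ℝ (Fin d))) : Prop :=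
  ∀ x ∈ K, Metric.infDist x (argminSet f K) ^ 2 ≤ 2 * α⁻¹ * (f x - optVal f K)

/-- A system `A₁ x = b₁, A₂ x ≤ b₂` of linear constraints on `ℝ^d`. -/
structure LinSystem (d m₁ m₂ : ℕ) where
  A₁ : Matrix (Fin m₁) (Fin d) ℝ
  b₁ : Fin m₁ → ℝ
  A₂ : Matrix (Fin m₂) (Fin d) ℝ
  b₂ : Fin m₂ → ℝ

namespace LinSystem

variable {d m₁ m₂ : ℕ} (P : LinSystem d m₁ m₂)

/-- The polyhedron `K = {x | A₁ x = b₁, A₂ x ≤ b₂}`. -/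
def polyhedron : Set (EuclideanSpace ℝ (Fin d)) :=
  {x | P.A₁ *ᵥ x.ofLp = P.b₁ ∧ ∀ i, (P.A₂ *ᵥ x.ofLp) i ≤ P.b₂ i}

/-- The vertices (extreme points) of the polyhedron. -/
def vertices : Set (EuclideanSpace ℝ (Fin d)) := P.polyhedron.extremePoints ℝ

/-- A face of the polyhedron: a nonempty subset obtained by turning some of the inequality
constraints into equalities. -/
def IsFace (F : Set (EuclideanSpace ℝ (Fin d))) : Prop :=
  F.Nonempty ∧ ∃ I : Set (Fin m₂),
    F = {x | x ∈ P.polyhedron ∧ ∀ i ∈ I, (P.A₂ *ᵥ x.ofLp) i = P.b₂ i}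

/-- The inequality constraints that are tight at all points of `F`. -/
def tightRows (F : Set (EuclideanSpace ℝ (Fin d))) : Set (Fin m₂) :=
  {i | ∀ x ∈ F, (P.A₂ *ᵥ x.ofLp) i = P.b₂ i}

/-- The inequality constraints that are tight at some points of `F` but not at others:
the rows of `A₂*` (when `F` is the optimal face). -/
def partlyTightRows (F : Set (EuclideanSpace ℝ (Fin d))) : Set (Fin m₂) :=
  {i | (∃ x ∈ F, (P.A₂ *ᵥ x.ofLp) i = P.b₂ i) ∧ ∃ x ∈ F, (P.A₂ *ᵥ x.ofLp) i ≠ P.b₂ i}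

/-- `dim F = d - dim span (rows of A₁ and rows of A₂ that are tight on F)`. The rank is at most
`d`, so the subtraction does not truncate. -/
def faceDim (F : Set (EuclideanSpace ℝ (Fin d))) : ℕ :=
  d - Module.finrank ℝ
    (Submodule.span ℝ (Set.range P.A₁.row ∪ P.A₂.row '' P.tightRows F))

/-- `F` is a face of lowest dimension among those that contain `X`. -/
def IsLowestFaceContaining (X F : Set (EuclideanSpace ℝ (Fin d))) : Prop :=
  P.IsFace F ∧ X ⊆ F ∧ ∀ G, P.IsFace G → X ⊆ G → P.faceDim F ≤ P.faceDim G

/-- The set `𝔸*` of the `dim F × d` matrices whose rows are linearly independent rows chosen from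
those of `A₂*`. -/
def rowMatrices (F : Set (EuclideanSpace ℝ (Fin d))) :
    Set (Matrix (Fin (P.faceDim F)) (Fin d) ℝ) :=
  {M | ∃ e : Fin (P.faceDim F) → Fin m₂, (∀ j, e j ∈ P.partlyTightRows F) ∧
    M = P.A₂.submatrix e id ∧ LinearIndependent ℝ M.row}

open scoped Matrix.Norms.L2Operator in
/-- `ψ`, the largest spectral norm of a matrix in `𝔸*`. -/
def psi (F : Set (EuclideanSpace ℝ (Fin d))) : ℝ :=
  sSup ((fun M : Matrix (Fin (P.faceDim F)) (Fin d) ℝ => ‖M‖) '' P.rowMatrices F)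

/-- `ξ`, the smallest positive slack of a constraint in `A₂*` at a vertex of the polyhedron that
lies in `F`. -/
def xi (F : Set (EuclideanSpace ℝ (Fin d))) : ℝ :=
  sInf {s | ∃ v ∈ P.vertices ∩ F, ∃ i ∈ P.partlyTightRows F,
    (P.A₂ *ᵥ v.ofLp) i < P.b₂ i ∧ s = P.b₂ i - (P.A₂ *ᵥ v.ofLp) i}

/-- `μ = ψ / ξ`. -/
def mu (F : Set (EuclideanSpace ℝ (Fin d))) : ℝ := P.psi F / P.xi F

/-- `κ = 2 μ² dim F / α`. It is `0` when `dim F = 0` (where `ξ` is a minimum over the empty set and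
is not used). -/
def kappa (F : Set (EuclideanSpace ℝ (Fin d))) (α : ℝ) : ℝ :=
  2 * P.mu F ^ 2 * (P.faceDim F : ℝ) / α

/-- `δ`-strict complementarity, with optimal face `F`. -/
def StrictComplementarity (f : EuclideanSpace ℝ (Fin d) → ℝ)
    (F : Set (EuclideanSpace ℝ (Fin d))) (δ : ℝ) : Prop :=
  ∀ x ∈ argminSet f P.polyhedron, ∀ v ∈ P.vertices,
    (v ∉ F → δ ≤ inner ℝ (v - x) (gradient f x)) ∧
    (v ∈ F → inner ℝ (v - x) (gradient f x) = 0)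

/-- A run of the Frank-Wolfe variant for polytopes with a nearest extreme point oracle and
parameters `ρ t`, `t = 1, 2, …` (values at `t = 0` are not used). In iteration `t` the iterate `x t`
is given by a convex decomposition into the vertices in `S t` with weights `w t`; `u t` is the vertex
returned by the oracle; ties in the minimizations are broken arbitrarily. -/
structure Run (f : EuclideanSpace ℝ (Fin d) → ℝ) (β : ℝ) (ρ : ℕ → ℝ) where
  x : ℕ → EuclideanSpace ℝ (Fin d)
  S : ℕ → Finset (EuclideanSpace ℝ (Fin d))
  w : ℕ → EuclideanSpace ℝ (Fin d) → ℝ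
  u : ℕ → EuclideanSpace ℝ (Fin d)
  init : x 1 ∈ P.vertices
  vertex : ∀ t ≥ 1, ∀ v ∈ S t, v ∈ P.vertices
  weight_nonneg : ∀ t ≥ 1, ∀ v ∈ S t, 0 ≤ w t v
  weight_sum : ∀ t ≥ 1, ∑ v ∈ S t, w t v = 1
  decomposition : ∀ t ≥ 1, ∑ v ∈ S t, w t v • v = x t
  oracle : ∀ t ≥ 1, u t ∈
    argminSet (fun v => inner ℝ v (gradient f (x t)) + β * ρ t * ‖v - x t‖ ^ 2) P.vertices
  /-- The first option minimizes the quadratic upper bound, the second one is fully corrective. -/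
  step : ∀ t ≥ 1,
    x (t + 1) ∈ argminSet
      (fun y => inner ℝ y (gradient f (x t)) + β / 2 * ‖y - x t‖ ^ 2)
      (convexHull ℝ (insert (u t) (S t : Set (EuclideanSpace ℝ (Fin d))))) ∨
    x (t + 1) ∈ argminSet f
      (convexHull ℝ (insert (u t) (S t : Set (EuclideanSpace ℝ (Fin d)))))

end LinSystem

/-- The parameters
`ρ_t = min {√(2 max {2κ, δ⁻¹} C exp (-(t - 1) / (4 M₁))), 1} / (2 M₁)`. -/
def rhoOne (κ δ C M₁ : ℝ) (t : ℕ) : ℝ :=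
  min (Real.sqrt (2 * max (2 * κ) δ⁻¹ * C * Real.exp (-((t : ℝ) - 1) / (4 * M₁)))) 1 / (2 * M₁)

/-- The parameters `ρ_t = min {2 δ κ exp (-(t - τ) / (8 M₂)), 1} / (2 M₂)`. -/
def rhoTwo (κ δ M₂ : ℝ) (τ t : ℕ) : ℝ :=
  min (2 * δ * κ * Real.exp (-((t : ℝ) - τ) / (8 * M₂))) 1 / (2 * M₂)

end NEPFrankWolfe

end

/-!
Let `x = ∑ w v • v` be an iterate, `h` its optimality gap and `y` the closest optimal solution. The
argument rests on a bound for the mass `Δ` of the decomposition that has to be moved to a single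
point `z` of the optimal face `F` in order to reach `y`, that is, to write
`y = ∑ w' v • v + Δ • z` with `0 ≤ w' ≤ w`.

All mass on vertices outside of `F` has to be moved. By convexity and strict complementarity this
part `p` is at most `h / δ`. For the vertices in `F`, choose `w'` as large as possible
(`IsFace.exists_maximal_weights`). At a vertex of `F` whose weight is not exhausted, some constraint
that is tight at `z` then has slack at least `ξ`, and one may take it among `dim F` linearly
independent rows (`IsFace.exists_rows`). Summing over these rows bounds the remaining part by
`q ≤ √(dim F) μ ‖x - y‖` (`IsFace.exists_decomposition`), and quadratic growth gives `q ^ 2 ≤ κ h`.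

If `s` bounds `Δ = p + q`, compare the next iterate with the point obtained from `x` by moving to the
oracle vertex `u` the fraction `η = 1 / (2 M)` of the mass. With `ρ = η s` the oracle's proximity term
absorbs `‖u - x‖ ^ 2`, so that only `diam F` and `‖x - y‖` enter the estimate
(`descent_estimate`), and any upper bound `B` for the gap shrinks by the factor `1 - 1 / (4 M)`
(`Run.gap_succ_le`). The two parameter choices correspond to two bounds on `p + q`: in general
`p + q ≤ min (√(2 max (2 κ) δ⁻¹ B)) 1`, and `p + q ≤ 2 √(κ B)` once `B ≤ δ² κ`. For the second one
the threshold `δ² κ` has to be positive, which holds when `dim F > 0` (`IsFace.kappa_pos`).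
-/

open scoped Matrix

namespace NEPFrankWolfe

namespace LinSystem

variable {d m₁ m₂ : ℕ} (P : LinSystem d m₁ m₂)

/-! ### Constraint functionals and the polyhedron -/

/-- The `k`-th row of `A₁` as a linear functional on `ℝ^d`. -/
noncomputable def eqForm (k : Fin m₁) : EuclideanSpace ℝ (Fin d) →ₗ[ℝ] ℝ :=
  LinearMap.proj k ∘ₗ P.A₁.mulVecLin ∘ₗ (WithLp.linearEquiv 2 ℝ (Fin d → ℝ)).toLinearMap

/-- The `i`-th row of `A₂` as a linear functional on `ℝ^d`. -/
noncomputable def ineqForm (i : Fin m₂) : EuclideanSpace ℝ (Fin d) →ₗ[ℝ] ℝ :=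
  LinearMap.proj i ∘ₗ P.A₂.mulVecLin ∘ₗ (WithLp.linearEquiv 2 ℝ (Fin d → ℝ)).toLinearMap

theorem eqForm_apply (k : Fin m₁) (x : EuclideanSpace ℝ (Fin d)) :
    P.eqForm k x = (P.A₁ *ᵥ x.ofLp) k := rfl

theorem ineqForm_apply (i : Fin m₂) (x : EuclideanSpace ℝ (Fin d)) :
    P.ineqForm i x = (P.A₂ *ᵥ x.ofLp) i := rfl

theorem mem_polyhedron {x : EuclideanSpace ℝ (Fin d)} :
    x ∈ P.polyhedron ↔ (∀ k, P.eqForm k x = P.b₁ k) ∧ ∀ i, P.ineqForm i x ≤ P.b₂ i := by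
  simp only [polyhedron, Set.mem_ofPred_eq, funext_iff]
  rfl

theorem mem_tightRows {F : Set (EuclideanSpace ℝ (Fin d))} {i : Fin m₂} :
    i ∈ P.tightRows F ↔ ∀ x ∈ F, P.ineqForm i x = P.b₂ i := Iff.rfl

theorem mem_partlyTightRows {F : Set (EuclideanSpace ℝ (Fin d))} {i : Fin m₂} :
    i ∈ P.partlyTightRows F ↔
      (∃ x ∈ F, P.ineqForm i x = P.b₂ i) ∧ ∃ x ∈ F, P.ineqForm i x ≠ P.b₂ i := Iff.rfl

theorem isClosed_polyhedron : IsClosed P.polyhedron := by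
  have h : P.polyhedron = (⋂ k, {x | P.eqForm k x = P.b₁ k}) ∩
      ⋂ i, {x | P.ineqForm i x ≤ P.b₂ i} := by
    ext x
    simp [mem_polyhedron]
  rw [h]
  exact (isClosed_iInter fun k => isClosed_eq
      (P.eqForm k).continuous_of_finiteDimensional continuous_const).inter
    (isClosed_iInter fun i => isClosed_le
      (P.ineqForm i).continuous_of_finiteDimensional continuous_const)

theorem convex_polyhedron : Convex ℝ P.polyhedron := by
  intro x hx y hy a b ha hb hab
  rw [mem_polyhedron] at *
  refine ⟨fun k => ?_, fun i => ?_⟩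
  · simp only [map_add, map_smul, smul_eq_mul, hx.1 k, hy.1 k]
    rw [← add_mul, hab, one_mul]
  · simp only [map_add, map_smul, smul_eq_mul]
    calc a * P.ineqForm i x + b * P.ineqForm i y ≤ a * P.b₂ i + b * P.b₂ i :=
          add_le_add (mul_le_mul_of_nonneg_left (hx.2 i) ha)
            (mul_le_mul_of_nonneg_left (hy.2 i) hb)
      _ = P.b₂ i := by rw [← add_mul, hab, one_mul]

theorem isCompact_polyhedron (hP : Bornology.IsBounded P.polyhedron) :
    IsCompact P.polyhedron :=
  Metric.isCompact_of_isClosed_isBounded P.isClosed_polyhedron hP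

/-- A bounded nonempty polyhedron has trivial recession cone. -/
theorem eq_zero_of_recession (hP : Bornology.IsBounded P.polyhedron)
    {x g : EuclideanSpace ℝ (Fin d)} (hx : x ∈ P.polyhedron) (h₁ : ∀ k, P.eqForm k g = 0)
    (h₂ : ∀ i, P.ineqForm i g ≤ 0) : g = 0 := by
  by_contra hg
  obtain ⟨R, hR⟩ := hP.exists_norm_le
  have hmem : ∀ t : ℝ, 0 ≤ t → x + t • g ∈ P.polyhedron := by
    intro t ht
    rw [mem_polyhedron] at hx ⊢
    refine ⟨fun k => by simp [h₁ k, hx.1 k], fun i => ?_⟩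
    simp only [map_add, map_smul, smul_eq_mul]
    have := mul_nonpos_of_nonneg_of_nonpos ht (h₂ i)
    linarith [hx.2 i]
  have hg' : 0 < ‖g‖ := norm_pos_iff.2 hg
  have hR0 : 0 ≤ R := (norm_nonneg x).trans (hR x hx)
  have ht : 0 ≤ (2 * R + 1) / ‖g‖ := by positivity
  have h1 := hR _ (hmem _ ht)
  have h2 : ‖((2 * R + 1) / ‖g‖) • g‖ = 2 * R + 1 := by
    rw [norm_smul, Real.norm_of_nonneg ht, div_mul_cancel₀ _ hg'.ne']
  have h3 : ‖((2 * R + 1) / ‖g‖) • g‖ ≤ ‖x + ((2 * R + 1) / ‖g‖) • g‖ + ‖x‖ := by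
    simpa using norm_sub_le (x + ((2 * R + 1) / ‖g‖) • g) x
  linarith [hR x hx]

/-! ### Faces -/

/-- A face is cut out of the polyhedron by the constraints that are tight on all of it. -/
theorem IsFace.mem_iff {P : LinSystem d m₁ m₂} {F : Set (EuclideanSpace ℝ (Fin d))}
    (hF : P.IsFace F) {x : EuclideanSpace ℝ (Fin d)} :
    x ∈ F ↔ x ∈ P.polyhedron ∧ ∀ i ∈ P.tightRows F, P.ineqForm i x = P.b₂ i := by
  obtain ⟨-, I, hI⟩ := hF
  constructor
  · intro hx
    refine ⟨?_, fun i hi => hi x hx⟩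
    rw [hI] at hx
    exact hx.1
  · rintro ⟨hxP, hx⟩
    rw [hI]
    refine ⟨hxP, fun i hi => hx i fun y hy => ?_⟩
    rw [hI] at hy
    exact hy.2 i hi

theorem IsFace.subset {P : LinSystem d m₁ m₂} {F : Set (EuclideanSpace ℝ (Fin d))}
    (hF : P.IsFace F) : F ⊆ P.polyhedron := fun _ hx => (hF.mem_iff.1 hx).1

theorem IsFace.isClosed {P : LinSystem d m₁ m₂} {F : Set (EuclideanSpace ℝ (Fin d))}
    (hF : P.IsFace F) : IsClosed F := by
  have h : F = P.polyhedron ∩ ⋂ i ∈ P.tightRows F, {x | P.ineqForm i x = P.b₂ i} := by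
    ext x
    rw [hF.mem_iff]
    simp
  rw [h]
  exact P.isClosed_polyhedron.inter (isClosed_biInter fun i _ => isClosed_eq
    (P.ineqForm i).continuous_of_finiteDimensional continuous_const)

theorem IsFace.isCompact {P : LinSystem d m₁ m₂} {F : Set (EuclideanSpace ℝ (Fin d))}
    (hF : P.IsFace F) (hP : Bornology.IsBounded P.polyhedron) : IsCompact F :=
  (P.isCompact_polyhedron hP).of_isClosed_subset hF.isClosed hF.subset

theorem IsFace.convex {P : LinSystem d m₁ m₂} {F : Set (EuclideanSpace ℝ (Fin d))}
    (hF : P.IsFace F) : Convex ℝ F := by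
  intro x hx y hy a b ha hb hab
  rw [hF.mem_iff] at *
  refine ⟨P.convex_polyhedron hx.1 hy.1 ha hb hab, fun i hi => ?_⟩
  simp only [map_add, map_smul, smul_eq_mul, hx.2 i hi, hy.2 i hi]
  rw [← add_mul, hab, one_mul]

theorem IsFace.isExtreme {P : LinSystem d m₁ m₂} {F : Set (EuclideanSpace ℝ (Fin d))}
    (hF : P.IsFace F) : IsExtreme ℝ P.polyhedron F := by
  refine ⟨hF.subset, fun x hx y hy z hz hzxy => ?_⟩
  rw [hF.mem_iff] at hz ⊢
  refine ⟨hx, fun i hi => ?_⟩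
  obtain ⟨a, b, ha, hb, hab, rfl⟩ := hzxy
  have h := hz.2 i hi
  simp only [map_add, map_smul, smul_eq_mul] at h
  have hx' := (P.mem_polyhedron.1 hx).2 i
  have hy' := (P.mem_polyhedron.1 hy).2 i
  refine le_antisymm hx' (le_of_not_gt fun hlt => ?_)
  have h1 := mul_lt_mul_of_pos_left hlt ha
  have h2 := mul_le_mul_of_nonneg_left hy' hb.le
  have h3 : a * P.b₂ i + b * P.b₂ i = P.b₂ i := by rw [← add_mul, hab, one_mul]
  linarith

theorem IsFace.extremePoints_subset {P : LinSystem d m₁ m₂}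
    {F : Set (EuclideanSpace ℝ (Fin d))} (hF : P.IsFace F) :
    F.extremePoints ℝ ⊆ P.vertices ∩ F := fun _ hx =>
  ⟨hF.isExtreme.extremePoints_subset_extremePoints hx, hx.1⟩

/-- A linear lower bound on the vertices of a face holds on the whole face. -/
theorem IsFace.le_of_forall_vertices {P : LinSystem d m₁ m₂}
    {F : Set (EuclideanSpace ℝ (Fin d))} (hF : P.IsFace F)
    (hP : Bornology.IsBounded P.polyhedron) (l : EuclideanSpace ℝ (Fin d) →ₗ[ℝ] ℝ) (c : ℝ)
    (h : ∀ v ∈ P.vertices ∩ F, c ≤ l v) : ∀ z ∈ F, c ≤ l z := by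
  have hcl : IsClosed {z | c ≤ l z} := isClosed_le continuous_const
    l.continuous_of_finiteDimensional
  have hcv : Convex ℝ {z | c ≤ l z} := convex_halfSpace_ge l.isLinear c
  intro z hz
  rw [← closure_convexHull_extremePoints (hF.isCompact hP) hF.convex] at hz
  exact closure_minimal (convexHull_min (fun v hv => h v (hF.extremePoints_subset hv)) hcv)
    hcl hz

/-! ### Vertices and slacks -/

/-- At a vertex, only the zero direction is annihilated by all tight constraints. -/
theorem eq_zero_of_forall_tight {v g : EuclideanSpace ℝ (Fin d)} (hv : v ∈ P.vertices)
    (h₁ : ∀ k, P.eqForm k g = 0) (h₂ : ∀ i, P.ineqForm i v = P.b₂ i → P.ineqForm i g = 0) :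
    g = 0 := by
  have hvP := P.mem_polyhedron.1 hv.1
  -- small steps in the direction `g` respect the constraints that are slack at `v`
  have key : ∀ᶠ ε : ℝ in nhds 0, ∀ i, P.ineqForm i (v + ε • g) ≤ P.b₂ i ∧
      P.ineqForm i (v - ε • g) ≤ P.b₂ i := by
    rw [Filter.eventually_all]
    intro i
    rcases (hvP.2 i).eq_or_lt with h | h
    · exact Filter.Eventually.of_forall fun ε => by simp [h₂ i h, h]
    · have hc : ∀ s : ℝ, ContinuousAt (fun ε : ℝ => P.ineqForm i v + s * ε * P.ineqForm i g) 0 :=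
        fun s => by fun_prop
      filter_upwards [(hc 1).eventually_lt continuousAt_const (by simpa using h),
        (hc (-1)).eventually_lt continuousAt_const (by simpa using h)] with ε h1 h2
      simp only [map_add, map_sub, map_smul, smul_eq_mul]
      constructor <;> linarith
  obtain ⟨ε, hε, hεpos⟩ := ((key.filter_mono nhdsWithin_le_nhds).and
    (self_mem_nhdsWithin : Set.Ioi (0 : ℝ) ∈ nhdsWithin 0 (Set.Ioi 0))).exists
  have hp : v + ε • g ∈ P.polyhedron := P.mem_polyhedron.2
    ⟨fun k => by simp [h₁ k, hvP.1 k], fun i => (hε i).1⟩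
  have hm : v - ε • g ∈ P.polyhedron := P.mem_polyhedron.2
    ⟨fun k => by simp [h₁ k, hvP.1 k], fun i => (hε i).2⟩
  have hseg : v ∈ openSegment ℝ (v + ε • g) (v - ε • g) :=
    ⟨1 / 2, 1 / 2, by norm_num, by norm_num, by norm_num, by module⟩
  have := hv.2 hp hm hseg
  have hz : ε • g = 0 := by simpa using this
  exact (smul_eq_zero.1 hz).resolve_left (ne_of_gt hεpos)

/-- A polyhedron has finitely many vertices, because a vertex is determined by the set of
constraints that are tight at it. -/
theorem finite_vertices : P.vertices.Finite := by
  refine Set.Finite.of_finite_image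
    (f := fun v => {i | P.ineqForm i v = P.b₂ i}) (Set.toFinite _) ?_
  intro v hv w hw hvw
  have hv' := (P.mem_polyhedron.1 hv.1).1
  have hw' := (P.mem_polyhedron.1 hw.1).1
  have h := P.eq_zero_of_forall_tight (g := w - v) hv
    (fun k => by simp [hv' k, hw' k]) (fun i hi => ?_)
  · exact (sub_eq_zero.1 h).symm
  · have hi' : P.ineqForm i w = P.b₂ i := (Set.ext_iff.1 hvw i).1 hi
    rw [map_sub, hi, hi', sub_self]

theorem finite_slacks (F : Set (EuclideanSpace ℝ (Fin d))) :
    {s | ∃ v ∈ P.vertices ∩ F, ∃ i ∈ P.partlyTightRows F,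
      (P.A₂ *ᵥ v.ofLp) i < P.b₂ i ∧ s = P.b₂ i - (P.A₂ *ᵥ v.ofLp) i}.Finite := by
  refine ((P.finite_vertices.prod (Set.finite_univ (α := Fin m₂))).image
    fun q => P.b₂ q.2 - (P.A₂ *ᵥ q.1.ofLp) q.2).subset ?_
  rintro s ⟨v, hv, i, -, -, rfl⟩
  exact ⟨(v, i), ⟨hv.1, trivial⟩, rfl⟩

theorem xi_le {F : Set (EuclideanSpace ℝ (Fin d))} {v : EuclideanSpace ℝ (Fin d)} {i : Fin m₂}
    (hv : v ∈ P.vertices ∩ F) (hi : i ∈ P.partlyTightRows F) (h : P.ineqForm i v < P.b₂ i) :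
    P.xi F ≤ P.b₂ i - P.ineqForm i v :=
  csInf_le (P.finite_slacks F).bddBelow ⟨v, hv, i, hi, h, rfl⟩

theorem xi_pos {F : Set (EuclideanSpace ℝ (Fin d))} {v : EuclideanSpace ℝ (Fin d)} {i : Fin m₂}
    (hv : v ∈ P.vertices ∩ F) (hi : i ∈ P.partlyTightRows F) (h : P.ineqForm i v < P.b₂ i) :
    0 < P.xi F := by
  have hne : {s | ∃ v ∈ P.vertices ∩ F, ∃ i ∈ P.partlyTightRows F,
      (P.A₂ *ᵥ v.ofLp) i < P.b₂ i ∧ s = P.b₂ i - (P.A₂ *ᵥ v.ofLp) i}.Nonempty :=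
    ⟨_, v, hv, i, hi, h, rfl⟩
  obtain ⟨w, -, j, -, hlt, hs⟩ := hne.csInf_mem (P.finite_slacks F)
  rw [xi, hs]
  exact sub_pos.2 hlt

open scoped Matrix.Norms.L2Operator in
theorem norm_le_psi {F : Set (EuclideanSpace ℝ (Fin d))}
    {M : Matrix (Fin (P.faceDim F)) (Fin d) ℝ} (hM : M ∈ P.rowMatrices F) : ‖M‖ ≤ P.psi F := by
  have hfin : (P.rowMatrices F).Finite := by
    refine (Set.finite_range fun e : Fin (P.faceDim F) → Fin m₂ =>
      P.A₂.submatrix e id).subset ?_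
    rintro M ⟨e, -, rfl, -⟩
    exact ⟨e, rfl⟩
  exact le_csSup (hfin.image _).bddAbove ⟨M, hM, rfl⟩

/-! ### Linearly independent rows -/

/-- The span of the rows of `A₁` and of the rows of `A₂` that are tight on `F`. -/
abbrev normalSpace (F : Set (EuclideanSpace ℝ (Fin d))) : Submodule ℝ (Fin d → ℝ) :=
  Submodule.span ℝ (Set.range P.A₁.row ∪ P.A₂.row '' P.tightRows F)

theorem finrank_quotient_normalSpace (F : Set (EuclideanSpace ℝ (Fin d))) :
    Module.finrank ℝ ((Fin d → ℝ) ⧸ P.normalSpace F) = P.faceDim F := by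
  rw [Submodule.finrank_quotient, faceDim, Module.finrank_fin_fun]

/-- Together with the normal space, the partly tight rows of a face of a polytope span the whole
space. -/
theorem IsFace.normalSpace_sup_span {P : LinSystem d m₁ m₂}
    {F : Set (EuclideanSpace ℝ (Fin d))} (hF : P.IsFace F)
    (hP : Bornology.IsBounded P.polyhedron) :
    P.normalSpace F ⊔ Submodule.span ℝ (P.A₂.row '' P.partlyTightRows F) = ⊤ := by
  by_contra hne
  obtain ⟨l, hl0, hl⟩ := Submodule.exists_le_ker_of_lt_top _ (lt_top_iff_ne_top.2 hne)
  obtain ⟨v, hv⟩ := (hF.isCompact hP).extremePoints_nonempty hF.1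
  obtain ⟨hvV, hvF⟩ := hF.extremePoints_subset hv
  -- the vector `g` representing `l` is annihilated by every constraint that is tight at `v`
  set g : Fin d → ℝ := fun i => l (Pi.single i 1) with hg
  have hlg : ∀ a : Fin d → ℝ, l a = a ⬝ᵥ g := by
    intro a
    conv_lhs => rw [pi_eq_sum_univ' a]
    simp [dotProduct, hg, map_sum]
  have hg0 : (WithLp.toLp 2 g : EuclideanSpace ℝ (Fin d)) = 0 := by
    refine P.eq_zero_of_forall_tight hvV (fun k => ?_) (fun i hi => ?_)
    · rw [eqForm_apply, Matrix.mulVec, ← hlg]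
      exact hl (le_sup_left (a := P.normalSpace F)
        (Submodule.subset_span (Or.inl ⟨k, rfl⟩)))
    · rw [ineqForm_apply, Matrix.mulVec, ← hlg]
      by_cases hit : i ∈ P.tightRows F
      · exact hl (le_sup_left (a := P.normalSpace F)
          (Submodule.subset_span (Or.inr ⟨i, hit, rfl⟩)))
      · refine hl (le_sup_right (a := P.normalSpace F)
          (Submodule.subset_span ⟨i, ⟨⟨v, hvF, hi⟩, ?_⟩, rfl⟩))
        rw [mem_tightRows] at hit
        push Not at hit
        exact hit
  have hg0' : g = 0 := by simpa using hg0
  exact hl0 (LinearMap.ext fun a => by rw [hlg, hg0']; simp)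

/-- From a set `T` of partly tight rows of a face one can select rows that, modulo the normal space,
span all of `T`, and complete them to `faceDim F` linearly independent partly tight rows. -/
theorem IsFace.exists_rows {P : LinSystem d m₁ m₂}
    {F : Set (EuclideanSpace ℝ (Fin d))} (hF : P.IsFace F)
    (hP : Bornology.IsBounded P.polyhedron) {T : Set (Fin m₂)} (hT : T ⊆ P.partlyTightRows F) :
    ∃ e : Fin (P.faceDim F) → Fin m₂, P.A₂.submatrix e id ∈ P.rowMatrices F ∧
      (∀ j, e j ∈ P.partlyTightRows F) ∧
      ∀ g : EuclideanSpace ℝ (Fin d), (∀ k, P.eqForm k g = 0) →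
        (∀ i ∈ P.tightRows F, P.ineqForm i g = 0) →
        (∀ j, e j ∈ T → P.ineqForm (e j) g = 0) → ∀ i ∈ T, P.ineqForm i g = 0 := by
  classical
  set W := P.normalSpace F
  set φ : Fin m₂ → (Fin d → ℝ) ⧸ W := fun i => W.mkQ (P.A₂.row i) with hφ
  obtain ⟨s, hsT, -, hs, hsli⟩ := exists_linearIndepOn_extension (K := ℝ) (v := φ)
    (linearIndepOn_empty ℝ φ) (Set.empty_subset T)
  obtain ⟨b, hbT, hsb, hb, hbli⟩ := exists_linearIndepOn_extension hsli (hsT.trans hT)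
  have hspan : ⊤ ≤ Submodule.span ℝ (Set.range fun i : b => φ i) := by
    have h1 : Submodule.span ℝ (φ '' P.partlyTightRows F) = ⊤ := by
      have h2 : φ '' P.partlyTightRows F = W.mkQ '' (P.A₂.row '' P.partlyTightRows F) := by
        rw [Set.image_image]
      have h3 := congrArg (Submodule.map W.mkQ) (hF.normalSpace_sup_span hP)
      rw [Submodule.map_sup, Submodule.map_top, Submodule.range_mkQ] at h3
      have h4 : Submodule.map W.mkQ (P.normalSpace F) = ⊥ := W.mkQ_map_self
      rw [h4, bot_sup_eq] at h3
      rw [h2, ← Submodule.map_span, h3]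
    rw [← h1, Submodule.span_le]
    have h4 : (Set.range fun i : b => φ i) = φ '' b := by
      rw [Set.image_eq_range]
    rw [h4]
    exact hb
  have hcard : Nat.card b = P.faceDim F := by
    rw [← P.finrank_quotient_normalSpace F]
    exact (Module.finrank_eq_nat_card_basis (Module.Basis.mk hbli hspan)).symm
  let σ : Fin (P.faceDim F) ≃ b := (finCongr hcard.symm).trans (Finite.equivFin b).symm
  refine ⟨fun j => σ j, ⟨fun j => σ j, fun j => hbT (σ j).2, rfl, ?_⟩,
    fun j => hbT (σ j).2, ?_⟩
  · have h5 : LinearIndependent ℝ fun j => φ (σ j) := hbli.comp σ σ.injective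
    exact LinearIndependent.of_comp W.mkQ h5
  · intro g hg₁ hg₂ hgT i hi
    let l : (Fin d → ℝ) →ₗ[ℝ] ℝ := (dotProductBilin ℝ ℝ).flip g.ofLp
    have hl : ∀ i, l (P.A₂.row i) = P.ineqForm i g := fun i => rfl
    have hW : W ≤ LinearMap.ker l := by
      refine Submodule.span_le.2 ?_
      rintro _ (⟨k, rfl⟩ | ⟨i, hi, rfl⟩)
      · exact hg₁ k
      · exact hg₂ i hi
    have hle : Submodule.span ℝ (φ '' s) ≤ LinearMap.ker (W.liftQ l hW) := by
      refine Submodule.span_le.2 ?_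
      rintro _ ⟨i, his, rfl⟩
      have h6 := hgT (σ.symm ⟨i, hsb his⟩) (by simpa using hsT his)
      have h7 : P.ineqForm i g = 0 := by simpa using h6
      simpa [hφ, hl] using h7
    have h8 := hle (hs ⟨i, hi, rfl⟩)
    simpa [hφ, hl] using h8

end LinSystem

namespace LinSystem

variable {d m₁ m₂ : ℕ} {P : LinSystem d m₁ m₂}

/-! ### Positivity of the condition number -/

/-- A face of positive dimension has a vertex with a positive slack among its partly tight rows, so
`ξ` is an infimum over a nonempty set. -/
theorem IsFace.exists_partlyTightRow_slack {F : Set (EuclideanSpace ℝ (Fin d))}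
    (hF : P.IsFace F) (hP : Bornology.IsBounded P.polyhedron) (hdim : 0 < P.faceDim F) :
    ∃ v ∈ P.vertices ∩ F, ∃ i ∈ P.partlyTightRows F, P.ineqForm i v < P.b₂ i := by
  obtain ⟨e, -, he, -⟩ := hF.exists_rows hP (Set.empty_subset _)
  set i := e ⟨0, hdim⟩
  have hi : i ∈ P.partlyTightRows F := he _
  obtain ⟨-, x, hxF, hx⟩ := P.mem_partlyTightRows.1 hi
  by_contra! hcon
  refine hx (le_antisymm ((P.mem_polyhedron.1 (hF.subset hxF)).2 i) ?_)
  exact hF.le_of_forall_vertices hP _ _ (fun v hv => hcon v hv i hi) x hxF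

theorem IsFace.psi_pos {F : Set (EuclideanSpace ℝ (Fin d))}
    (hF : P.IsFace F) (hP : Bornology.IsBounded P.polyhedron) (hdim : 0 < P.faceDim F) :
    0 < P.psi F := by
  open scoped Matrix.Norms.L2Operator in
  obtain ⟨e, he, -, -⟩ := hF.exists_rows hP (Set.empty_subset _)
  refine lt_of_lt_of_le (norm_pos_iff.2 fun h0 => ?_) (P.norm_le_psi he)
  obtain ⟨e', -, -, hli⟩ := he
  refine hli.ne_zero ⟨0, hdim⟩ ?_
  rw [h0]
  rfl

theorem IsFace.kappa_pos {F : Set (EuclideanSpace ℝ (Fin d))}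
    (hF : P.IsFace F) (hP : Bornology.IsBounded P.polyhedron) (hdim : 0 < P.faceDim F)
    {α : ℝ} (hα : 0 < α) : 0 < P.kappa F α := by
  obtain ⟨v, hv, i, hi, h⟩ := hF.exists_partlyTightRow_slack hP hdim
  have h1 := P.xi_pos hv hi h
  have h2 := hF.psi_pos hP hdim
  have h3 : (0 : ℝ) < P.faceDim F := by exact_mod_cast hdim
  unfold kappa mu
  positivity

/-! ### Moving mass to a point of a face -/

theorem sum_mul_slack {S : Finset (EuclideanSpace ℝ (Fin d))}
    (w : EuclideanSpace ℝ (Fin d) → ℝ) (i : Fin m₂) :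
    ∑ v ∈ S, w v * (P.b₂ i - P.ineqForm i v) =
      (∑ v ∈ S, w v) * P.b₂ i - P.ineqForm i (∑ v ∈ S, w v • v) := by
  simp [mul_sub, Finset.sum_sub_distrib, Finset.sum_mul]

/-- The spectral norm bound for the selected rows, in coordinates. -/
theorem rowMatrices_sum_sq_le {F : Set (EuclideanSpace ℝ (Fin d))}
    {e : Fin (P.faceDim F) → Fin m₂} (he : P.A₂.submatrix e id ∈ P.rowMatrices F)
    (g : EuclideanSpace ℝ (Fin d)) :
    ∑ j, P.ineqForm (e j) g ^ 2 ≤ P.psi F ^ 2 * ‖g‖ ^ 2 := by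
  open scoped Matrix.Norms.L2Operator in
  have h1 := Matrix.l2_opNorm_mulVec (P.A₂.submatrix e id) g
  have h2 := P.norm_le_psi he
  have h3 : ∑ j, P.ineqForm (e j) g ^ 2 = ‖(EuclideanSpace.equiv (Fin (P.faceDim F)) ℝ).symm
      ((P.A₂.submatrix e id) *ᵥ g.ofLp)‖ ^ 2 := by
    rw [EuclideanSpace.real_norm_sq_eq]
    rfl
  rw [h3, ← mul_pow]
  exact pow_le_pow_left₀ (norm_nonneg _)
    (h1.trans (mul_le_mul_of_nonneg_right h2 (norm_nonneg _))) 2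

/-- Weights `w'` dominated by `w` and supported on the face `F`, of maximal total mass subject to
the condition that a point of `F` can supply the rest of a convex decomposition of `y`. In terms of
slacks this condition is linear in `w'`, and maximality shows up as complementary slackness: a
vertex of `F` whose weight is not exhausted has a slack constraint that is tight at the supplied
point. -/
theorem IsFace.exists_maximal_weights {F : Set (EuclideanSpace ℝ (Fin d))} (hF : P.IsFace F)
    {y : EuclideanSpace ℝ (Fin d)} (hy : y ∈ F) {S : Finset (EuclideanSpace ℝ (Fin d))}
    {w : EuclideanSpace ℝ (Fin d) → ℝ} (hS : ∀ v ∈ S, v ∈ P.vertices)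
    (hw : ∀ v ∈ S, 0 ≤ w v) :
    ∃ w' : EuclideanSpace ℝ (Fin d) → ℝ, (∀ v ∈ S, 0 ≤ w' v) ∧
      (∀ v ∈ S, w' v ≤ F.indicator w v) ∧
      (∀ i, ∑ v ∈ S, w' v * (P.b₂ i - P.ineqForm i v) ≤ P.b₂ i - P.ineqForm i y) ∧
      ∀ v ∈ S, v ∈ F → w' v < w v → ∃ i, P.ineqForm i v < P.b₂ i ∧
        ∑ v ∈ S, w' v * (P.b₂ i - P.ineqForm i v) = P.b₂ i - P.ineqForm i y := by
  classical
  set c : EuclideanSpace ℝ (Fin d) → ℝ := (↑S ∩ F : Set _).indicator w with hc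
  have hcS : ∀ v ∈ S, c v = F.indicator w v := by
    intro v hv
    by_cases hvF : v ∈ F <;> simp [hc, hv, hvF]
  have hc0 : 0 ≤ c := fun v => Set.indicator_nonneg (fun v hv => hw v hv.1) v
  set A : Set (EuclideanSpace ℝ (Fin d) → ℝ) := Set.Icc 0 c ∩
    {w' | ∀ i, ∑ v ∈ S, w' v * (P.b₂ i - P.ineqForm i v) ≤ P.b₂ i - P.ineqForm i y} with hA
  have hcomp : IsCompact A := by
    refine isCompact_Icc.inter_right ?_
    simp only [Set.ofPred_forall]
    refine isClosed_iInter fun i => isClosed_le ?_ continuous_const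
    fun_prop
  have hne : A.Nonempty := by
    refine ⟨0, ⟨le_rfl, hc0⟩, fun i => ?_⟩
    simpa using (P.mem_polyhedron.1 (hF.subset hy)).2 i
  obtain ⟨w', ⟨⟨hw0, hwc⟩, hfeas⟩, hmax⟩ := hcomp.exists_isMaxOn hne
    (f := fun w' => ∑ v ∈ S, w' v) (by fun_prop)
  refine ⟨w', fun v _ => hw0 v, fun v hv => (hwc v).trans_eq (hcS v hv), hfeas, ?_⟩
  intro v hv hvF hlt
  by_contra! hcon
  have hvP := (P.mem_polyhedron.1 (hS v hv).1).2
  -- otherwise a little more weight could be put on `v`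
  have key : ∀ᶠ ε : ℝ in nhds 0, w' v + ε ≤ w v ∧
      ∀ i, ∑ u ∈ S, w' u * (P.b₂ i - P.ineqForm i u) + ε * (P.b₂ i - P.ineqForm i v) ≤
        P.b₂ i - P.ineqForm i y := by
    refine Filter.Eventually.and ?_ (Filter.eventually_all.2 fun i => ?_)
    · have h1 : ContinuousAt (fun ε : ℝ => w' v + ε) 0 := by fun_prop
      exact (h1.eventually_lt continuousAt_const (by simpa using hlt)).mono fun _ h => h.le
    · rcases (hvP i).eq_or_lt with h | h
      · exact Filter.Eventually.of_forall fun ε => by simpa [h] using hfeas i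
      · have h1 : ContinuousAt (fun ε : ℝ => ∑ u ∈ S, w' u * (P.b₂ i - P.ineqForm i u) +
          ε * (P.b₂ i - P.ineqForm i v)) 0 := by fun_prop
        refine (h1.eventually_lt continuousAt_const ?_).mono fun _ h => h.le
        simpa using lt_of_le_of_ne (hfeas i) (hcon i h)
  obtain ⟨ε, ⟨hε1, hε2⟩, hεpos⟩ := ((key.filter_mono nhdsWithin_le_nhds).and
    (self_mem_nhdsWithin : Set.Ioi (0 : ℝ) ∈ nhdsWithin 0 (Set.Ioi 0))).exists
  have hεpos' : 0 < ε := hεpos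
  have hmem : (fun u => w' u + if u = v then ε else 0) ∈ A := by
    refine ⟨⟨fun u => ?_, fun u => ?_⟩, fun i => ?_⟩
    · exact add_nonneg (hw0 u) (by split_ifs <;> simp [hεpos'.le])
    · by_cases huv : u = v
      · subst huv
        simpa [hc, hv, hvF] using hε1
      · simpa [huv] using hwc u
    · simpa [add_mul, Finset.sum_add_distrib, ite_mul, hv] using hε2 i
  have := hmax hmem
  simp only [Set.mem_ofPred_eq, Finset.sum_add_distrib, Finset.sum_ite_eq', hv, if_true] at this
  linarith

/-- Given a convex decomposition `x = ∑ w v • v` into vertices and a point `y` of the face `F`, the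
point `y` is reached from `x` by moving mass to a single point `z` of `F`. Besides the mass that `x`
puts outside of `F`, the mass to be moved is at most `μ √(dim F) ‖x - y‖`. -/
theorem IsFace.exists_decomposition {F : Set (EuclideanSpace ℝ (Fin d))} (hF : P.IsFace F)
    (hP : Bornology.IsBounded P.polyhedron)
    {y : EuclideanSpace ℝ (Fin d)} (hy : y ∈ F) {S : Finset (EuclideanSpace ℝ (Fin d))}
    {w : EuclideanSpace ℝ (Fin d) → ℝ} (hS : ∀ v ∈ S, v ∈ P.vertices)
    (hw : ∀ v ∈ S, 0 ≤ w v) (hw1 : ∑ v ∈ S, w v = 1) :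
    ∃ w' : EuclideanSpace ℝ (Fin d) → ℝ, (∀ v ∈ S, 0 ≤ w' v) ∧ (∀ v ∈ S, w' v ≤ w v) ∧
      ∃ z ∈ F, y = ∑ v ∈ S, w' v • v + (1 - ∑ v ∈ S, w' v) • z ∧
        (1 - ∑ v ∈ S, w' v - ∑ v ∈ S, Fᶜ.indicator w v) ^ 2 ≤
          P.faceDim F * P.mu F ^ 2 * ‖∑ v ∈ S, w v • v - y‖ ^ 2 := by
  classical
  obtain ⟨w', hw'0, hw'F, hfeas, hmax⟩ := hF.exists_maximal_weights hy hS hw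
  have hind : ∀ v ∈ S, F.indicator w v ≤ w v := fun v hv =>
    Set.indicator_le_self' (fun _ _ => hw v hv) v
  have hw'w : ∀ v ∈ S, w' v ≤ w v := fun v hv => (hw'F v hv).trans (hind v hv)
  have hout : ∀ v ∈ S, v ∉ F → w' v = 0 := fun v hv hvF =>
    le_antisymm (by simpa [hvF] using hw'F v hv) (hw'0 v hv)
  have hyP := P.mem_polyhedron.1 (hF.subset hy)
  have hSP : ∀ v ∈ S, v ∈ P.polyhedron := fun v hv => (hS v hv).1
  set σ : ℝ := 1 - ∑ v ∈ S, w' v with hσ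
  have hσ0 : 0 ≤ σ := by
    have := Finset.sum_le_sum hw'w
    linarith
  set m : EuclideanSpace ℝ (Fin d) := y - ∑ v ∈ S, w' v • v with hm
  have hm₁ : ∀ k, P.eqForm k m = σ * P.b₁ k := by
    intro k
    have : ∑ v ∈ S, w' v * P.eqForm k v = ∑ v ∈ S, w' v * P.b₁ k :=
      Finset.sum_congr rfl fun v hv => by rw [(P.mem_polyhedron.1 (hSP v hv)).1 k]
    simp only [hm, map_sub, map_sum, map_smul, smul_eq_mul, this, ← Finset.sum_mul, hyP.1 k, hσ]
    ring
  have hm₂ : ∀ i, σ * P.b₂ i - P.ineqForm i m =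
      (P.b₂ i - P.ineqForm i y) - ∑ v ∈ S, w' v * (P.b₂ i - P.ineqForm i v) := by
    intro i
    rw [sum_mul_slack, hm, map_sub, hσ]
    ring
  have hm₃ : ∀ i ∈ P.tightRows F, P.ineqForm i m = σ * P.b₂ i := by
    intro i hi
    have h0 : ∑ v ∈ S, w' v * (P.b₂ i - P.ineqForm i v) = 0 :=
      Finset.sum_eq_zero fun v hv => by
        by_cases hvF : v ∈ F
        · rw [(P.mem_tightRows.1 hi) v hvF, sub_self, mul_zero]
        · rw [hout v hv hvF, zero_mul]
    have := hm₂ i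
    rw [h0, (P.mem_tightRows.1 hi) y hy] at this
    linarith
  obtain ⟨z, hzF, hz⟩ : ∃ z ∈ F, m = σ • z := by
    rcases hσ0.eq_or_lt with h | h
    · -- no mass is left: the remainder `m` is a recession direction, so it vanishes
      refine ⟨y, hy, ?_⟩
      rw [← h, zero_smul]
      refine P.eq_zero_of_recession hP (hF.subset hy) (fun k => by rw [hm₁, ← h, zero_mul])
        fun i => ?_
      have h1 := hm₂ i
      have h2 := hfeas i
      rw [← h, zero_mul] at h1
      linarith
    · refine ⟨σ⁻¹ • m, ?_, (smul_inv_smul₀ h.ne' m).symm⟩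
      rw [hF.mem_iff, P.mem_polyhedron]
      refine ⟨⟨fun k => ?_, fun i => ?_⟩, fun i hi => ?_⟩
      · rw [map_smul, hm₁, smul_eq_mul, inv_mul_cancel_left₀ h.ne']
      · rw [map_smul, smul_eq_mul, inv_mul_le_iff₀ h]
        have h1 := hm₂ i
        have h2 := hfeas i
        linarith
      · rw [map_smul, hm₃ i hi, smul_eq_mul, inv_mul_cancel_left₀ h.ne']
  refine ⟨w', hw'0, hw'w, z, hzF, by rw [← hz, hm]; abel, ?_⟩
  set q : ℝ := ∑ v ∈ S, (F.indicator w v - w' v) with hq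
  have hqσ : σ - ∑ v ∈ S, Fᶜ.indicator w v = q := by
    have h1 : ∑ v ∈ S, (F.indicator w v + Fᶜ.indicator w v) = 1 := by
      rw [← hw1]
      exact Finset.sum_congr rfl fun v _ => by
        rw [← Pi.add_apply, Set.indicator_self_add_compl]
    rw [Finset.sum_add_distrib] at h1
    rw [hq, Finset.sum_sub_distrib, hσ]
    linarith
  rw [hqσ]
  have hq0 : 0 ≤ q := Finset.sum_nonneg fun v hv => sub_nonneg.2 (hw'F v hv)
  rcases hq0.eq_or_lt with hq0 | hq0
  · -- here `ξ` may be the infimum of the empty set, and nothing is needed of it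
    rw [← hq0, zero_pow two_ne_zero]
    positivity
  have hσpos : 0 < σ := by
    have h1 : 0 ≤ ∑ v ∈ S, Fᶜ.indicator w v := Finset.sum_nonneg fun v hv =>
      Set.indicator_apply_nonneg fun _ => hw v hv
    linarith
  set T : Set (Fin m₂) := {i | i ∈ P.partlyTightRows F ∧
    ∑ v ∈ S, w' v * (P.b₂ i - P.ineqForm i v) = P.b₂ i - P.ineqForm i y} with hT
  have hzT : ∀ i, ∑ v ∈ S, w' v * (P.b₂ i - P.ineqForm i v) = P.b₂ i - P.ineqForm i y →
      P.ineqForm i z = P.b₂ i := by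
    intro i hi
    have h1 := hm₂ i
    rw [hi, hz, map_smul, smul_eq_mul, sub_self, ← mul_sub] at h1
    have := (mul_eq_zero.1 h1).resolve_left hσpos.ne'
    linarith
  obtain ⟨e, heM, heP, heT⟩ := hF.exists_rows hP (T := T) fun i hi => hi.1
  have hzP := P.mem_polyhedron.1 (hF.subset hzF)
  -- every vertex of `F` with unexhausted weight has a slack constraint among the chosen tight rows
  have hsep : ∀ v ∈ S, v ∈ F → w' v < w v → ∃ j, e j ∈ T ∧ P.ineqForm (e j) v < P.b₂ (e j) := by
    intro v hv hvF hlt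
    obtain ⟨i, hi, hiy⟩ := hmax v hv hvF hlt
    have hiT : i ∈ T := ⟨P.mem_partlyTightRows.2 ⟨⟨z, hzF, hzT i hiy⟩, v, hvF, hi.ne⟩, hiy⟩
    by_contra! hcon
    have hvP := P.mem_polyhedron.1 (hSP v hv)
    have h0 := heT (v - z) (fun k => by rw [map_sub, hvP.1 k, hzP.1 k, sub_self])
      (fun i hi => by
        rw [map_sub, (P.mem_tightRows.1 hi) v hvF, (P.mem_tightRows.1 hi) z hzF, sub_self])
      (fun j hj => by
        rw [map_sub, le_antisymm (hvP.2 (e j)) (hcon j hj), hzT _ hj.2, sub_self]) i hiT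
    rw [map_sub, hzT i hiy] at h0
    linarith
  have hξ0 : 0 < P.xi F := by
    obtain ⟨v, hv, hvpos⟩ := Finset.exists_lt_of_sum_lt
      (show ∑ v ∈ S, (0 : ℝ) < ∑ v ∈ S, (F.indicator w v - w' v) by simpa [← hq] using hq0)
    have hvF : v ∈ F := by
      by_contra hvF
      have := hw'0 v hv
      simp only [Set.indicator_of_notMem hvF] at hvpos
      linarith
    rw [Set.indicator_of_mem hvF] at hvpos
    obtain ⟨j, hj, hjv⟩ := hsep v hv hvF (sub_pos.1 hvpos)
    exact P.xi_pos ⟨hS v hv, hvF⟩ hj.1 hjv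
  set x := ∑ v ∈ S, w v • v with hx
  have hslack : ∀ v ∈ S, ∀ i, 0 ≤ P.b₂ i - P.ineqForm i v := fun v hv i =>
    sub_nonneg.2 ((P.mem_polyhedron.1 (hSP v hv)).2 i)
  have hqξ : q * P.xi F ≤ ∑ j, |P.ineqForm (e j) (x - y)| := by
    calc q * P.xi F = ∑ v ∈ S, (F.indicator w v - w' v) * P.xi F := by rw [hq, Finset.sum_mul]
      _ ≤ ∑ v ∈ S, (w v - w' v) *
            ∑ j with e j ∈ T, (P.b₂ (e j) - P.ineqForm (e j) v) := by
          refine Finset.sum_le_sum fun v hv => ?_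
          have hnn : 0 ≤ ∑ j with e j ∈ T, (P.b₂ (e j) - P.ineqForm (e j) v) :=
            Finset.sum_nonneg fun j _ => hslack v hv _
          by_cases hvF : v ∈ F
          · rw [Set.indicator_of_mem hvF]
            rcases (hw'w v hv).eq_or_lt with h | h
            · simp [h]
            · refine mul_le_mul_of_nonneg_left ?_ (sub_nonneg.2 h.le)
              obtain ⟨j, hj, hjv⟩ := hsep v hv hvF h
              exact (P.xi_le ⟨hS v hv, hvF⟩ hj.1 hjv).trans
                (Finset.single_le_sum (f := fun j => P.b₂ (e j) - P.ineqForm (e j) v)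
                  (fun j _ => hslack v hv _) (by simpa using hj))
          · rw [Set.indicator_of_notMem hvF, hout v hv hvF, sub_zero, zero_mul, sub_zero]
            exact mul_nonneg (hw v hv) hnn
      _ = ∑ j with e j ∈ T, ∑ v ∈ S, (w v - w' v) * (P.b₂ (e j) - P.ineqForm (e j) v) := by
          simp only [Finset.mul_sum]
          exact Finset.sum_comm
      _ = ∑ j with e j ∈ T, -P.ineqForm (e j) (x - y) := by
          refine Finset.sum_congr rfl fun j hj => ?_
          have hj' : e j ∈ T := by simpa using hj
          simp only [sub_mul, Finset.sum_sub_distrib, hj'.2, sum_mul_slack, hw1]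
          rw [← hx, map_sub]
          ring
      _ ≤ ∑ j with e j ∈ T, |P.ineqForm (e j) (x - y)| :=
          Finset.sum_le_sum fun j _ => neg_le_abs _
      _ ≤ ∑ j, |P.ineqForm (e j) (x - y)| :=
          Finset.sum_le_univ_sum_of_nonneg fun j => abs_nonneg _
  have hsq : (q * P.xi F) ^ 2 ≤ P.faceDim F * (P.psi F ^ 2 * ‖x - y‖ ^ 2) := by
    calc (q * P.xi F) ^ 2 ≤ (∑ j, |P.ineqForm (e j) (x - y)|) ^ 2 :=
          pow_le_pow_left₀ (by positivity) hqξ 2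
      _ ≤ P.faceDim F * ∑ j, P.ineqForm (e j) (x - y) ^ 2 := by
          simpa using sq_sum_le_card_mul_sum_sq (s := Finset.univ)
            (f := fun j => |P.ineqForm (e j) (x - y)|)
      _ ≤ _ := mul_le_mul_of_nonneg_left (rowMatrices_sum_sq_le heM _) (Nat.cast_nonneg _)
  rw [mul_pow, ← le_div_iff₀ (by positivity)] at hsq
  refine hsq.trans_eq ?_
  rw [mu]
  ring

end LinSystem

variable {d : ℕ}

/-! ### Convex functions, minimizers and elementary estimates -/

theorem ConvexOn.add_inner_gradient_le {K : Set (EuclideanSpace ℝ (Fin d))}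
    {f : EuclideanSpace ℝ (Fin d) → ℝ} (hf : ConvexOn ℝ K f) {x y : EuclideanSpace ℝ (Fin d)}
    (hx : x ∈ K) (hy : y ∈ K) (hd : DifferentiableAt ℝ f x) :
    f x + inner ℝ (y - x) (gradient f x) ≤ f y := by
  have h1 := hf.comp_affineMap (AffineMap.lineMap x y : ℝ →ᵃ[ℝ] EuclideanSpace ℝ (Fin d))
  have h2 : HasDerivAt (f ∘ (AffineMap.lineMap x y : ℝ →ᵃ[ℝ] EuclideanSpace ℝ (Fin d)))
      (inner ℝ (gradient f x) (y - x)) 0 := by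
    have h3 : HasFDerivAt f (InnerProductSpace.toDual ℝ _ (gradient f x))
        ((AffineMap.lineMap x y : ℝ →ᵃ[ℝ] EuclideanSpace ℝ (Fin d)) 0) := by
      rw [AffineMap.lineMap_apply_zero]
      exact hd.hasGradientAt.hasFDerivAt
    have h4 := h3.comp_hasDerivAt (0 : ℝ)
      (AffineMap.hasDerivAt_lineMap (a := x) (b := y) (x := (0 : ℝ)))
    simpa using h4
  have h5 := h1.le_slope_of_hasDerivAt (x := 0) (y := 1) (by simpa using hx) (by simpa using hy)
    one_pos h2
  rw [real_inner_comm] at h5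
  simp only [slope_def_field, Function.comp_apply, AffineMap.lineMap_apply_one,
    AffineMap.lineMap_apply_zero, sub_zero, div_one] at h5
  linarith

theorem optVal_eq {E : Type*} {f : E → ℝ} {K : Set E} {y : E} (hy : y ∈ argminSet f K) :
    optVal f K = f y := by
  have h : IsLeast (f '' K) (f y) :=
    ⟨⟨y, hy.1, rfl⟩, by rintro _ ⟨x, hx, rfl⟩; exact hy.2 x hx⟩
  exact h.csInf_eq

theorem isCompact_argminSet {K : Set (EuclideanSpace ℝ (Fin d))}
    {f : EuclideanSpace ℝ (Fin d) → ℝ} (hK : IsCompact K) (hf : ContinuousOn f K) :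
    IsCompact (argminSet f K) := by
  rcases (argminSet f K).eq_empty_or_nonempty with h | ⟨y, hy⟩
  · rw [h]
    exact isCompact_empty
  · have h1 : argminSet f K = K ∩ f ⁻¹' Set.Iic (f y) := by
      ext x
      exact ⟨fun hx => ⟨hx.1, hx.2 y hy.1⟩, fun hx => ⟨hx.1, fun u hu => hx.2.trans (hy.2 u hu)⟩⟩
    rw [h1]
    exact hK.of_isClosed_subset (hf.preimage_isClosed_of_isClosed hK.isClosed isClosed_Iic)
      Set.inter_subset_left

theorem argminSet_nonempty {K : Set (EuclideanSpace ℝ (Fin d))}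
    {f : EuclideanSpace ℝ (Fin d) → ℝ} (hK : IsCompact K) (hne : K.Nonempty)
    (hf : ContinuousOn f K) : (argminSet f K).Nonempty := by
  obtain ⟨y, hy, hmin⟩ := hK.exists_isMinOn hne hf
  exact ⟨y, hy, fun x hx => hmin hx⟩

theorem norm_add_sq_le_two_mul {E : Type*} [SeminormedAddCommGroup E] (a b : E) :
    ‖a + b‖ ^ 2 ≤ 2 * ‖a‖ ^ 2 + 2 * ‖b‖ ^ 2 := by
  have h := pow_le_pow_left₀ (norm_nonneg _) (norm_add_le a b) 2
  nlinarith [sq_nonneg (‖a‖ - ‖b‖)]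

/-- The change of the quadratic model between `x` and the comparison point
`x + η • (Δ • (u - z) + (y - x))`. The term `U = ‖u - x‖ ^ 2` cancels against the proximity term of
the oracle. -/
theorem descent_estimate {β η Δ s D R U N a b c h : ℝ} (hβ : 0 ≤ β) (hη : 0 ≤ η) (hΔ : 0 ≤ Δ)
    (hΔs : Δ ≤ s) (hs : s ≤ 1) (hR : 0 ≤ R) (hU : 0 ≤ U)
    (horacle : a + β * (η * s) * U ≤ b + β * (η * s) * (2 * D ^ 2 + 2 * R)) (hgrad : c ≤ -h)
    (hN : N ≤ η ^ 2 * (2 * (Δ ^ 2 * U) +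
      2 * (2 * (Δ ^ 2 * D ^ 2) + 2 * ((1 - Δ) ^ 2 * R)))) :
    η * (Δ * (a - b) + c) + β / 2 * N ≤
      -(η * h) + β * η ^ 2 * (4 * s ^ 2 * D ^ 2 + 2 * R) := by
  have hquad : Δ * s * (2 * D ^ 2 + 2 * R - U) + Δ ^ 2 * U +
      2 * (Δ ^ 2 * D ^ 2) + 2 * ((1 - Δ) ^ 2 * R) ≤ 4 * s ^ 2 * D ^ 2 + 2 * R := by
    have h1 : Δ ^ 2 ≤ Δ * s := by nlinarith
    have h2 : Δ * s ≤ s ^ 2 := by nlinarith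
    have h3 : Δ * s + (1 - Δ) ^ 2 ≤ 1 := by nlinarith
    have h4 := mul_le_mul_of_nonneg_right h1 hU
    have h5 := mul_le_mul_of_nonneg_right h2 (sq_nonneg D)
    have h6 := mul_le_mul_of_nonneg_right (h1.trans h2) (sq_nonneg D)
    have h7 := mul_le_mul_of_nonneg_right h3 hR
    linarith
  have h1 := mul_le_mul_of_nonneg_left hquad (show 0 ≤ β * η ^ 2 by positivity)
  have h2 := mul_le_mul_of_nonneg_left hN (show 0 ≤ β / 2 by positivity)
  have h3 := mul_le_mul_of_nonneg_left horacle (show 0 ≤ η * Δ by positivity)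
  have h4 := mul_le_mul_of_nonneg_left hgrad hη
  linarith

theorem Convex.sum_add_mem {E : Type*} [AddCommGroup E] [Module ℝ E] {C : Set E}
    (hC : Convex ℝ C) {S : Finset E} {w : E → ℝ} {u : E} {a : ℝ} (hS : ∀ v ∈ S, v ∈ C)
    (hw : ∀ v ∈ S, 0 ≤ w v) (hu : u ∈ C) (ha : 0 ≤ a) (hsum : ∑ v ∈ S, w v + a = 1) :
    ∑ v ∈ S, w v • v + a • u ∈ C := by
  have h := hC.sum_mem (t := Finset.insertNone S) (w := fun o => o.elim a w)
    (z := fun o => o.elim u id) ?_ ?_ ?_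
  · simpa [Finset.sum_insertNone, add_comm] using h
  · rintro (_ | v) hv
    · exact ha
    · exact hw v (by simpa using hv)
  · simpa [Finset.sum_insertNone, add_comm] using hsum
  · rintro (_ | v) hv
    · exact hu
    · exact hS v (by simpa using hv)

namespace LinSystem

variable {m₁ m₂ : ℕ} {P : LinSystem d m₁ m₂}

/-! ### One iteration -/

theorem kappa_nonneg (F : Set (EuclideanSpace ℝ (Fin d))) {α : ℝ} (hα : 0 < α) :
    0 ≤ P.kappa F α := by
  unfold kappa
  positivity

theorem Run.mem_polyhedron {f : EuclideanSpace ℝ (Fin d) → ℝ} {β : ℝ} {ρ : ℕ → ℝ}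
    (r : P.Run f β ρ) {t : ℕ} (ht : 1 ≤ t) : r.x t ∈ P.polyhedron := by
  rw [← r.decomposition t ht]
  exact P.convex_polyhedron.sum_mem (r.weight_nonneg t ht) (r.weight_sum t ht)
    fun v hv => (r.vertex t ht v hv).1

/-- The optimal solution `y` closest to a point `x = ∑ w v • v` is reached by moving to a single
point `z` of the optimal face a mass of at most `p + q`. Here `p`, the mass that `x` puts outside of
the optimal face, is controlled by strict complementarity, and `q` by quadratic growth. -/
theorem IsFace.exists_optimal_decomposition {F : Set (EuclideanSpace ℝ (Fin d))}
    (hF : P.IsFace F) (hP : Bornology.IsBounded P.polyhedron)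
    {f : EuclideanSpace ℝ (Fin d) → ℝ} (hconv : ConvexOn ℝ P.polyhedron f)
    (hdiff : ∀ x ∈ P.polyhedron, DifferentiableAt ℝ f x)
    {α : ℝ} (hqg : QuadraticGrowth f α P.polyhedron)
    (hXF : argminSet f P.polyhedron ⊆ F)
    {δ : ℝ} (hδ : 0 < δ) (hsc : P.StrictComplementarity f F δ)
    {x : EuclideanSpace ℝ (Fin d)} {S : Finset (EuclideanSpace ℝ (Fin d))}
    {w : EuclideanSpace ℝ (Fin d) → ℝ} (hS : ∀ v ∈ S, v ∈ P.vertices)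
    (hw : ∀ v ∈ S, 0 ≤ w v) (hw1 : ∑ v ∈ S, w v = 1) (hx : ∑ v ∈ S, w v • v = x) :
    ∃ y ∈ argminSet f P.polyhedron,
      ‖x - y‖ ^ 2 ≤ 2 / α * (f x - optVal f P.polyhedron) ∧
      ∃ w' : EuclideanSpace ℝ (Fin d) → ℝ, (∀ v ∈ S, 0 ≤ w' v) ∧ (∀ v ∈ S, w' v ≤ w v) ∧
      ∃ z ∈ F, y = ∑ v ∈ S, w' v • v + (1 - ∑ v ∈ S, w' v) • z ∧
      ∃ p q : ℝ, 1 - ∑ v ∈ S, w' v = p + q ∧ 0 ≤ p ∧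
        p ≤ (f x - optVal f P.polyhedron) / δ ∧
        q ^ 2 ≤ P.kappa F α * (f x - optVal f P.polyhedron) := by
  have hK := P.isCompact_polyhedron hP
  have hcont : ContinuousOn f P.polyhedron := fun x hx =>
    (hdiff x hx).continuousAt.continuousWithinAt
  have hxP : x ∈ P.polyhedron := by
    rw [← hx]
    exact P.convex_polyhedron.sum_mem hw hw1 fun v hv => (hS v hv).1
  obtain ⟨y, hyX, hxy⟩ := (isCompact_argminSet hK hcont).exists_infDist_eq_dist
    (argminSet_nonempty hK ⟨x, hxP⟩ hcont) x
  have hr : ‖x - y‖ ^ 2 ≤ 2 / α * (f x - optVal f P.polyhedron) := by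
    have := hqg x hxP
    rwa [hxy, dist_eq_norm, ← div_eq_mul_inv] at this
  obtain ⟨w', hw'0, hw'w, z, hz, hyz, hq⟩ := hF.exists_decomposition hP (hXF hyX) hS hw hw1
  refine ⟨y, hyX, hr, w', hw'0, hw'w, z, hz, hyz, ∑ v ∈ S, Fᶜ.indicator w v,
    1 - ∑ v ∈ S, w' v - ∑ v ∈ S, Fᶜ.indicator w v, by ring,
    Finset.sum_nonneg fun v hv => Set.indicator_apply_nonneg fun _ => hw v hv, ?_, ?_⟩
  · rw [le_div_iff₀ hδ]
    have h1 := ConvexOn.add_inner_gradient_le hconv hyX.1 hxP (hdiff y hyX.1)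
    have h2 : inner ℝ (x - y) (gradient f y) =
        ∑ v ∈ S, w v * inner ℝ (v - y) (gradient f y) := by
      have h3 : x - y = ∑ v ∈ S, w v • (v - y) := by
        simp only [smul_sub, Finset.sum_sub_distrib, hx, ← Finset.sum_smul, hw1, one_smul]
      rw [h3, sum_inner]
      simp only [real_inner_smul_left]
    have h4 : (∑ v ∈ S, Fᶜ.indicator w v) * δ ≤ inner ℝ (x - y) (gradient f y) := by
      rw [h2, Finset.sum_mul]
      refine Finset.sum_le_sum fun v hv => ?_
      by_cases hvF : v ∈ F
      · rw [(hsc y hyX v (hS v hv)).2 hvF]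
        simp [hvF]
      · rw [Set.indicator_of_mem (show v ∈ Fᶜ from hvF)]
        exact mul_le_mul_of_nonneg_left ((hsc y hyX v (hS v hv)).1 hvF) (hw v hv)
    rw [optVal_eq hyX]
    linarith
  · rw [hx] at hq
    refine hq.trans ((mul_le_mul_of_nonneg_left hr (by positivity)).trans_eq ?_)
    rw [kappa]
    ring

/-- One iteration of the method, for a parameter `ρ t = s / (2 M)` such that `s` bounds the mass
that has to be moved to reach the nearest optimal solution from `x t`. -/
theorem Run.gap_succ_le {F : Set (EuclideanSpace ℝ (Fin d))}
    (hF : P.IsFace F) (hP : Bornology.IsBounded P.polyhedron)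
    {f : EuclideanSpace ℝ (Fin d) → ℝ} (hconv : ConvexOn ℝ P.polyhedron f)
    {β : ℝ} (hβ : 0 ≤ β) (hsmooth : IsSmoothOn f β P.polyhedron)
    {α : ℝ} (hα : 0 < α) (hXF : argminSet f P.polyhedron ⊆ F)
    {ρ : ℕ → ℝ} (r : P.Run f β ρ) {t : ℕ} (ht : 1 ≤ t)
    {B s M : ℝ} (hB : f (r.x t) - optVal f P.polyhedron ≤ B) (hs : s ≤ 1) (hM : 1 / 2 ≤ M)
    (hρ : ρ t = s / (2 * M)) (hMB : 4 * β / α * B + 4 * β * s ^ 2 * Metric.diam F ^ 2 ≤ M * B)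
    {y : EuclideanSpace ℝ (Fin d)} (hy : y ∈ argminSet f P.polyhedron)
    (hxy : ‖r.x t - y‖ ^ 2 ≤ 2 / α * (f (r.x t) - optVal f P.polyhedron))
    {w' : EuclideanSpace ℝ (Fin d) → ℝ} (hw'0 : ∀ v ∈ r.S t, 0 ≤ w' v)
    (hw'w : ∀ v ∈ r.S t, w' v ≤ r.w t v) {z : EuclideanSpace ℝ (Fin d)} (hz : z ∈ F)
    (hyz : y = ∑ v ∈ r.S t, w' v • v + (1 - ∑ v ∈ r.S t, w' v) • z)
    (hΔs : 1 - ∑ v ∈ r.S t, w' v ≤ s) :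
    f (r.x (t + 1)) - optVal f P.polyhedron ≤ (1 - 1 / (4 * M)) * B := by
  set x := r.x t with hx
  set Δ := 1 - ∑ v ∈ r.S t, w' v with hΔ
  set g := gradient f x with hg
  set u := r.u t with hu
  set D := Metric.diam F with hD
  set η : ℝ := 1 / (2 * M) with hη
  set Q : Set (EuclideanSpace ℝ (Fin d)) :=
    convexHull ℝ (insert u (r.S t : Set (EuclideanSpace ℝ (Fin d)))) with hQ
  have hM0 : 0 < M := by linarith
  have hη0 : 0 < η := by positivity
  have hη1 : η ≤ 1 := by
    rw [hη, div_le_one (by positivity)]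
    linarith
  have hηM : η * M = 1 / 2 := by
    rw [hη]
    field_simp
  have hΔ0 : 0 ≤ Δ := by
    have h1 := Finset.sum_le_sum hw'w
    rw [r.weight_sum t ht] at h1
    linarith
  have hxP : x ∈ P.polyhedron := r.mem_polyhedron ht
  have huV : u ∈ P.vertices := (r.oracle t ht).1
  have hQP : Q ⊆ P.polyhedron := by
    refine convexHull_min ?_ P.convex_polyhedron
    rintro v (rfl | hv)
    · exact huV.1
    · exact (r.vertex t ht v hv).1
  have hSQ : ∀ v ∈ r.S t, v ∈ Q := fun v hv => subset_convexHull ℝ _ (Or.inr hv)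
  have hQc : Convex ℝ Q := convex_convexHull ℝ _
  -- the comparison point moves the fraction `η` of the mass that `y` requires, but to `u`
  set Y := x + η • (Δ • (u - z) + (y - x)) with hY
  have hYQ : Y ∈ Q := by
    have h1 : x ∈ Q := by
      rw [hx, ← r.decomposition t ht]
      exact hQc.sum_mem (r.weight_nonneg t ht) (r.weight_sum t ht) hSQ
    have h2 : ∑ v ∈ r.S t, w' v • v + Δ • u ∈ Q :=
      Convex.sum_add_mem hQc hSQ hw'0 (subset_convexHull ℝ _ (Or.inl rfl)) hΔ0
        (by rw [hΔ]; ring)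
    have h3 := hQc h1 h2 (sub_nonneg.2 hη1) hη0.le (by ring)
    convert h3 using 1
    have h4 : ∑ v ∈ r.S t, w' v • v = y - Δ • z := by rw [hyz]; abel
    rw [hY, h4]
    module
  have hdescent : f (r.x (t + 1)) ≤ f x + inner ℝ (Y - x) g + β / 2 * ‖Y - x‖ ^ 2 := by
    rcases r.step t ht with h | h
    · have h1 := hsmooth.2 x hxP _ (hQP h.1)
      have h2 := h.2 Y hYQ
      simp only [inner_sub_left] at h1 ⊢
      linarith
    · exact (h.2 Y hYQ).trans (hsmooth.2 x hxP _ (hQP hYQ))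
  have hFb : Bornology.IsBounded F := hP.subset hF.subset
  have hFD : ∀ a ∈ F, ∀ b ∈ F, ‖a - b‖ ^ 2 ≤ D ^ 2 := fun a ha b hb => by
    rw [← dist_eq_norm]
    exact pow_le_pow_left₀ dist_nonneg (Metric.dist_le_diam_of_mem hFb ha hb) 2
  have hyF := hXF hy
  set R := ‖x - y‖ ^ 2 with hR
  set U := ‖u - x‖ ^ 2 with hU
  have hR' : ‖y - x‖ ^ 2 = R := by rw [hR, norm_sub_rev]
  have hρ' : ρ t = η * s := by
    rw [hρ, hη]
    ring
  have hs0 : 0 ≤ s := hΔ0.trans hΔs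
  have horacle : inner ℝ u g + β * (η * s) * U ≤
      inner ℝ z g + β * (η * s) * (2 * D ^ 2 + 2 * R) := by
    have h1 : ∀ v ∈ P.vertices ∩ F,
        inner ℝ u g + β * (η * s) * U - β * (η * s) * (2 * D ^ 2 + 2 * R) ≤ innerₗ _ g v := by
      rintro v ⟨hvV, hvF⟩
      have h2 : inner ℝ u g + β * ρ t * U ≤ inner ℝ v g + β * ρ t * ‖v - x‖ ^ 2 :=
        (r.oracle t ht).2 v hvV
      rw [hρ'] at h2
      have h3 : ‖v - x‖ ^ 2 ≤ 2 * D ^ 2 + 2 * R := by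
        have h4 := norm_add_sq_le_two_mul (v - y) (y - x)
        rw [sub_add_sub_cancel, hR'] at h4
        linarith [hFD v hvF y hyF]
      have h5 := mul_le_mul_of_nonneg_left h3 (show 0 ≤ β * (η * s) by positivity)
      rw [innerₗ_apply_apply, real_inner_comm v g]
      linarith
    have h6 := hF.le_of_forall_vertices hP _ _ h1 z hz
    rw [innerₗ_apply_apply, real_inner_comm z g] at h6
    linarith
  have hgrad : inner ℝ (y - x) g ≤ -(f x - optVal f P.polyhedron) := by
    have h1 := ConvexOn.add_inner_gradient_le hconv hxP hy.1 (hsmooth.1 x hxP)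
    rw [optVal_eq hy]
    linarith
  have hnorm : ‖Y - x‖ ^ 2 ≤ η ^ 2 * (2 * (Δ ^ 2 * U) +
      2 * (2 * (Δ ^ 2 * D ^ 2) + 2 * ((1 - Δ) ^ 2 * R))) := by
    have h1 : Y - x = η • (Δ • (u - x) + (Δ • (y - z) + (1 - Δ) • (y - x))) := by
      rw [hY]
      module
    have h2 := norm_add_sq_le_two_mul (Δ • (u - x)) (Δ • (y - z) + (1 - Δ) • (y - x))
    have h3 := norm_add_sq_le_two_mul (Δ • (y - z)) ((1 - Δ) • (y - x))
    have h4 := mul_le_mul_of_nonneg_left (hFD y hyF z hz) (sq_nonneg Δ)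
    rw [h1, norm_smul, mul_pow, Real.norm_eq_abs, sq_abs]
    simp only [norm_smul, mul_pow, Real.norm_eq_abs, sq_abs] at h2 h3
    rw [hR'] at h3
    refine mul_le_mul_of_nonneg_left ?_ (sq_nonneg η)
    rw [← hU] at h2
    linarith
  have hinner : inner ℝ (Y - x) g = η * (Δ * (inner ℝ u g - inner ℝ z g) + inner ℝ (y - x) g) := by
    rw [hY, add_sub_cancel_left, real_inner_smul_left, inner_add_left, real_inner_smul_left,
      inner_sub_left u z]
  set h := f x - optVal f P.polyhedron with hh
  have hR0 : 0 ≤ R := by positivity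
  have hU0 : 0 ≤ U := by positivity
  have hRB : R ≤ 2 / α * B := hxy.trans (mul_le_mul_of_nonneg_left hB (by positivity))
  have hstep : f (r.x (t + 1)) - optVal f P.polyhedron ≤
      (1 - η) * h + β * η ^ 2 * (4 * s ^ 2 * D ^ 2 + 2 * R) := by
    have h1 := descent_estimate hβ hη0.le hΔ0 hΔs hs hR0 hU0 horacle hgrad hnorm
    rw [hinner] at hdescent
    linarith
  calc f (r.x (t + 1)) - optVal f P.polyhedron
      ≤ (1 - η) * h + β * η ^ 2 * (4 * s ^ 2 * D ^ 2 + 2 * R) := hstep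
    _ ≤ (1 - η) * B + β * η ^ 2 * (4 * s ^ 2 * D ^ 2 + 2 * (2 / α * B)) := by
        gcongr
    _ = (1 - η) * B + η ^ 2 * (4 * β / α * B + 4 * β * s ^ 2 * D ^ 2) := by ring
    _ ≤ (1 - η) * B + η ^ 2 * (M * B) := by gcongr
    _ = (1 - η + η * (η * M)) * B := by ring
    _ = (1 - 1 / (4 * M)) * B := by
        rw [hηM, hη]
        field_simp
        ring

/-- Linear convergence over one iteration, in terms of any bound `s` on the mass `p + q` that has
to be moved from `x t`. -/
theorem Run.gap_succ_le_mul_exp {F : Set (EuclideanSpace ℝ (Fin d))}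
    (hF : P.IsFace F) (hP : Bornology.IsBounded P.polyhedron)
    {f : EuclideanSpace ℝ (Fin d) → ℝ} (hconv : ConvexOn ℝ P.polyhedron f)
    {β : ℝ} (hβ : 0 ≤ β) (hsmooth : IsSmoothOn f β P.polyhedron)
    {α : ℝ} (hα : 0 < α) (hqg : QuadraticGrowth f α P.polyhedron)
    (hXF : argminSet f P.polyhedron ⊆ F)
    {δ : ℝ} (hδ : 0 < δ) (hsc : P.StrictComplementarity f F δ)
    {ρ : ℕ → ℝ} (r : P.Run f β ρ) {t : ℕ} (ht : 1 ≤ t)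
    {B s M : ℝ} (hB : f (r.x t) - optVal f P.polyhedron ≤ B) (hs : s ≤ 1) (hM : 1 / 2 ≤ M)
    (hρ : ρ t = s / (2 * M)) (hMB : 4 * β / α * B + 4 * β * s ^ 2 * Metric.diam F ^ 2 ≤ M * B)
    (hmass : ∀ p q : ℝ, 0 ≤ p → p + q ≤ 1 → p ≤ B / δ → q ^ 2 ≤ P.kappa F α * B → p + q ≤ s) :
    f (r.x (t + 1)) - optVal f P.polyhedron ≤ B * Real.exp (-1 / (4 * M)) := by
  obtain ⟨y, hy, hxy, w', hw'0, hw'w, z, hz, hyz, p, q, hpq, hp0, hp, hq⟩ :=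
    hF.exists_optimal_decomposition hP hconv hsmooth.1 hqg hXF hδ hsc (r.vertex t ht)
      (r.weight_nonneg t ht) (r.weight_sum t ht) (r.decomposition t ht)
  have hB0 : 0 ≤ B := by
    have h1 := hy.2 _ (r.mem_polyhedron ht)
    rw [optVal_eq hy] at hB
    linarith
  have hpq1 : p + q ≤ 1 := by
    rw [← hpq, sub_le_self_iff]
    exact Finset.sum_nonneg hw'0
  have hΔs := hmass p q hp0 hpq1 (hp.trans (by gcongr))
    (hq.trans (mul_le_mul_of_nonneg_left hB (kappa_nonneg F hα)))
  rw [← hpq] at hΔs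
  refine (r.gap_succ_le hF hP hconv hβ hsmooth hα hXF ht hB hs hM hρ hMB hy hxy hw'0 hw'w hz hyz
    hΔs).trans ?_
  rw [mul_comm]
  refine mul_le_mul_of_nonneg_left ?_ hB0
  have h := Real.add_one_le_exp (-1 / (4 * M))
  linarith [neg_div (4 * M) (1 : ℝ)]

end LinSystem

/-! ### Parameter choices and rates -/

/-- The mass bound `p + q` in terms of the gap, without any relation between `κ` and `δ⁻¹`. -/
theorem add_le_min_sqrt {p q κ δ B : ℝ} (hB : 0 ≤ B) (hp0 : 0 ≤ p)
    (hpq : p + q ≤ 1) (hp : p ≤ B / δ) (hq : q ^ 2 ≤ κ * B) :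
    p + q ≤ min (Real.sqrt (2 * max (2 * κ) δ⁻¹ * B)) 1 := by
  refine le_min ?_ hpq
  set m := max (2 * κ) δ⁻¹ with hm
  have h1 : 2 * κ * B ≤ m * B := mul_le_mul_of_nonneg_right (le_max_left _ _) hB
  have h2 : B / δ ≤ m * B := by
    rw [div_eq_inv_mul]
    exact mul_le_mul_of_nonneg_right (le_max_right _ _) hB
  rcases le_or_gt 1 (2 * m * B) with h | h
  · exact hpq.trans (Real.one_le_sqrt.2 h)
  · -- here `p ≤ 1 / 2`, so that `2 * p ^ 2 ≤ p ≤ B / δ`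
    refine Real.le_sqrt_of_sq_le ?_
    nlinarith [sq_nonneg (p - q)]

theorem min_sqrt_sq_le {a : ℝ} (ha : 0 ≤ a) : min (Real.sqrt a) 1 ^ 2 ≤ a :=
  (pow_le_pow_left₀ (le_min (Real.sqrt_nonneg a) zero_le_one) (min_le_left _ _) 2).trans_eq
    (Real.sq_sqrt ha)

/-- The mass bound `p + q` when the gap is at most `δ ^ 2 * κ * c ^ 2` with `c ≤ 1`: then `B / δ` and
`√(κ * B)` are both at most `δ * κ * c`. -/
theorem add_le_min_of_le_one {p q κ δ c : ℝ} (hδ : 0 < δ) (hκ : 0 ≤ κ) (hc0 : 0 ≤ c)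
    (hc1 : c ≤ 1) (hpq : p + q ≤ 1) (hp : p ≤ δ ^ 2 * κ * c ^ 2 / δ)
    (hq : q ^ 2 ≤ κ * (δ ^ 2 * κ * c ^ 2)) : p + q ≤ min (2 * δ * κ * c) 1 := by
  refine le_min ?_ hpq
  have h1 : p ≤ δ * κ * c := by
    calc p ≤ δ ^ 2 * κ * c ^ 2 / δ := hp
      _ = δ * κ * c * c := by field_simp
      _ ≤ δ * κ * c := mul_le_of_le_one_right (by positivity) hc1
  have h2 : q ≤ δ * κ * c := le_of_sq_le_sq (hq.trans_eq (by ring)) (by positivity)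
  linarith

theorem min_one_sq_le {a : ℝ} (ha : 0 ≤ a) : min a 1 ^ 2 ≤ a ^ 2 :=
  pow_le_pow_left₀ (le_min ha zero_le_one) (min_le_left _ _) 2

namespace LinSystem

variable {d m₁ m₂ : ℕ} {P : LinSystem d m₁ m₂}

/-- The rate with the first choice of parameters, for as long as these parameters are used. -/
theorem Run.gap_le_of_rhoOne {F : Set (EuclideanSpace ℝ (Fin d))}
    (hF : P.IsFace F) (hP : Bornology.IsBounded P.polyhedron)
    {f : EuclideanSpace ℝ (Fin d) → ℝ} (hconv : ConvexOn ℝ P.polyhedron f)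
    {β : ℝ} (hβ : 0 ≤ β) (hsmooth : IsSmoothOn f β P.polyhedron)
    {α : ℝ} (hα : 0 < α) (hqg : QuadraticGrowth f α P.polyhedron)
    (hXF : argminSet f P.polyhedron ⊆ F)
    {δ : ℝ} (hδ : 0 < δ) (hsc : P.StrictComplementarity f F δ) {C M : ℝ} (hC : 0 ≤ C)
    (hM : max (4 * β / α + 8 * β * Metric.diam F ^ 2 * max (2 * P.kappa F α) δ⁻¹) (1 / 2) ≤ M)
    {ρ : ℕ → ℝ} (r : P.Run f β ρ) (hinit : f (r.x 1) - optVal f P.polyhedron ≤ C) {T : ℕ}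
    (hρ : ∀ t, 1 ≤ t → t < T → ρ t = rhoOne (P.kappa F α) δ C M t) :
    ∀ t, 1 ≤ t → t ≤ T →
      f (r.x t) - optVal f P.polyhedron ≤ C * Real.exp (-((t : ℝ) - 1) / (4 * M)) := by
  intro t ht
  induction t, ht using Nat.le_induction with
  | base =>
    intro _
    simpa using hinit
  | succ t ht ih =>
    intro htT
    set m := max (2 * P.kappa F α) δ⁻¹ with hm
    set B := C * Real.exp (-((t : ℝ) - 1) / (4 * M)) with hB
    have hB0 : 0 ≤ B := by positivity
    have hm0 : 0 ≤ m := (inv_pos.2 hδ).le.trans (le_max_right _ _)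
    have ha : 2 * m * C * Real.exp (-((t : ℝ) - 1) / (4 * M)) = 2 * m * B := by
      rw [hB, mul_assoc]
    have hs := min_sqrt_sq_le (show 0 ≤ 2 * m * B by positivity)
    have hMB : 4 * β / α * B + 4 * β * min (Real.sqrt (2 * m * B)) 1 ^ 2 * Metric.diam F ^ 2 ≤
        M * B := by
      calc _ ≤ 4 * β / α * B + 4 * β * (2 * m * B) * Metric.diam F ^ 2 := by gcongr
        _ = (4 * β / α + 8 * β * Metric.diam F ^ 2 * m) * B := by ring
        _ ≤ M * B := mul_le_mul_of_nonneg_right ((le_max_left _ _).trans hM) hB0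
    have h := r.gap_succ_le_mul_exp hF hP hconv hβ hsmooth hα hqg hXF hδ hsc ht
      (ih (by omega)) (min_le_right _ _) ((le_max_right _ _).trans hM)
      (by rw [hρ t ht (by omega), rhoOne, ← hm, ha]) hMB
      (fun p q hp0 hpq hp hq => add_le_min_sqrt hB0 hp0 hpq hp hq)
    refine h.trans_eq ?_
    rw [hB, mul_assoc, ← Real.exp_add]
    push_cast
    ring_nf

/-- The rate with the second choice of parameters, once the gap is at most `δ² κ`. -/
theorem Run.gap_le_of_rhoTwo {F : Set (EuclideanSpace ℝ (Fin d))}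
    (hF : P.IsFace F) (hP : Bornology.IsBounded P.polyhedron)
    {f : EuclideanSpace ℝ (Fin d) → ℝ} (hconv : ConvexOn ℝ P.polyhedron f)
    {β : ℝ} (hβ : 0 ≤ β) (hsmooth : IsSmoothOn f β P.polyhedron)
    {α : ℝ} (hα : 0 < α) (hqg : QuadraticGrowth f α P.polyhedron)
    (hXF : argminSet f P.polyhedron ⊆ F)
    {δ : ℝ} (hδ : 0 < δ) (hsc : P.StrictComplementarity f F δ) {M : ℝ}
    (hM : max (4 * β / α + 16 * β * P.kappa F α * Metric.diam F ^ 2) (1 / 2) ≤ M)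
    {ρ : ℕ → ℝ} (r : P.Run f β ρ) {τ : ℕ} (hτ : 1 ≤ τ)
    (hinit : f (r.x τ) - optVal f P.polyhedron ≤ δ ^ 2 * P.kappa F α)
    (hρ : ∀ t, τ ≤ t → ρ t = rhoTwo (P.kappa F α) δ M τ t) :
    ∀ t, τ ≤ t → f (r.x t) - optVal f P.polyhedron ≤
      δ ^ 2 * P.kappa F α * Real.exp (-((t : ℝ) - τ) / (4 * M)) := by
  intro t ht
  induction t, ht using Nat.le_induction with
  | base => simpa using hinit
  | succ t ht ih =>
    have hM' : 1 / 2 ≤ M := (le_max_right _ _).trans hM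
    set κ := P.kappa F α with hκ
    set c := Real.exp (-((t : ℝ) - τ) / (8 * M)) with hc
    have hκ0 : 0 ≤ κ := kappa_nonneg F hα
    have hc0 : 0 ≤ c := (Real.exp_pos _).le
    have hc1 : c ≤ 1 := by
      have h1 : (τ : ℝ) ≤ t := by exact_mod_cast ht
      exact Real.exp_le_one_iff.2 (div_nonpos_of_nonpos_of_nonneg (by linarith) (by linarith))
    have hcc : Real.exp (-((t : ℝ) - τ) / (4 * M)) = c ^ 2 := by
      have hM0 : M ≠ 0 := by linarith
      rw [hc, ← Real.exp_nat_mul]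
      congr 1
      push_cast
      field_simp
      ring
    rw [hcc] at ih
    have hs := min_one_sq_le (show 0 ≤ 2 * δ * κ * c by positivity)
    have hMB : 4 * β / α * (δ ^ 2 * κ * c ^ 2) +
        4 * β * min (2 * δ * κ * c) 1 ^ 2 * Metric.diam F ^ 2 ≤ M * (δ ^ 2 * κ * c ^ 2) := by
      calc _ ≤ 4 * β / α * (δ ^ 2 * κ * c ^ 2) +
            4 * β * (2 * δ * κ * c) ^ 2 * Metric.diam F ^ 2 := by gcongr
        _ = (4 * β / α + 16 * β * κ * Metric.diam F ^ 2) * (δ ^ 2 * κ * c ^ 2) := by ring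
        _ ≤ M * (δ ^ 2 * κ * c ^ 2) :=
          mul_le_mul_of_nonneg_right ((le_max_left _ _).trans hM) (by positivity)
    have h := r.gap_succ_le_mul_exp hF hP hconv hβ hsmooth hα hqg hXF hδ hsc (hτ.trans ht)
      ih (min_le_right _ _) hM' (hρ t ht) hMB
      (fun p q _ hpq hp hq => add_le_min_of_le_one hδ hκ0 hc0 hc1 hpq hp hq)
    refine h.trans_eq ?_
    rw [← hcc, mul_assoc, ← Real.exp_add]
    push_cast
    ring_nf

end LinSystem

end NEPFrankWolfe

theorem theorem4 {d m₁ m₂ : ℕ} (P : NEPFrankWolfe.LinSystem d m₁ m₂)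
    (hP : Bornology.IsBounded P.polyhedron)
    (f : EuclideanSpace ℝ (Fin d) → ℝ) (hconv : ConvexOn ℝ P.polyhedron f)
    (β : ℝ) (hβ : 0 ≤ β) (hsmooth : NEPFrankWolfe.IsSmoothOn f β P.polyhedron)
    (α : ℝ) (hα : 0 < α) (hqg : NEPFrankWolfe.QuadraticGrowth f α P.polyhedron)
    (F : Set (EuclideanSpace ℝ (Fin d)))
    (hF : P.IsLowestFaceContaining (NEPFrankWolfe.argminSet f P.polyhedron) F)
    (δ : ℝ) (hδ : 0 < δ) (hsc : P.StrictComplementarity f F δ)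
    (C M₁ : ℝ)
    (hM₁ : max (4 * β / α + 8 * β * Metric.diam F ^ 2 * max (2 * P.kappa F α) δ⁻¹) (1 / 2) ≤ M₁) :
    (∀ r : P.Run f β (NEPFrankWolfe.rhoOne (P.kappa F α) δ C M₁),
      f (r.x 1) - NEPFrankWolfe.optVal f P.polyhedron ≤ C →
      ∀ t : ℕ, 1 ≤ t →
        f (r.x t) - NEPFrankWolfe.optVal f P.polyhedron
          ≤ C * Real.exp (-((t : ℝ) - 1) / (4 * M₁))) ∧
    (2 * P.kappa F α ≤ δ⁻¹ → 0 < P.faceDim F →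
      ∀ M₂ : ℝ,
        max (4 * β / α + 16 * β * P.kappa F α * Metric.diam F ^ 2) (1 / 2) ≤ M₂ →
      ∀ τ : ℕ, 1 ≤ τ → 4 * M₁ * Real.log (C / (δ ^ 2 * P.kappa F α)) + 1 ≤ (τ : ℝ) →
      ∀ r : P.Run f β (fun t => if t < τ then NEPFrankWolfe.rhoOne (P.kappa F α) δ C M₁ t
          else NEPFrankWolfe.rhoTwo (P.kappa F α) δ M₂ τ t),
        f (r.x 1) - NEPFrankWolfe.optVal f P.polyhedron ≤ C →
        ∀ t : ℕ, τ ≤ t →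
          f (r.x t) - NEPFrankWolfe.optVal f P.polyhedron
            ≤ δ ^ 2 * P.kappa F α * Real.exp (-((t : ℝ) - τ) / (4 * M₂))) := by
  obtain ⟨hface, hXF, -⟩ := hF
  have hC : ∀ {ρ : ℕ → ℝ} (r : P.Run f β ρ),
      f (r.x 1) - NEPFrankWolfe.optVal f P.polyhedron ≤ C → 0 ≤ C := by
    intro ρ r h
    have hcont : ContinuousOn f P.polyhedron := fun x hx =>
      (hsmooth.1 x hx).continuousAt.continuousWithinAt
    obtain ⟨y, hy⟩ := NEPFrankWolfe.argminSet_nonempty (P.isCompact_polyhedron hP)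
      ⟨r.x 1, r.init.1⟩ hcont
    rw [NEPFrankWolfe.optVal_eq hy] at h
    linarith [hy.2 _ r.init.1]
  refine ⟨fun r hr t ht => ?_, fun _ hdim M₂ hM₂ τ hτ hτC r hr => ?_⟩
  · exact r.gap_le_of_rhoOne hface hP hconv hβ hsmooth hα hqg hXF hδ hsc (hC r hr) hM₁ hr
      (T := t) (fun _ _ _ => rfl) t ht le_rfl
  · refine r.gap_le_of_rhoTwo hface hP hconv hβ hsmooth hα hqg hXF hδ hsc hM₂ hτ ?_
      (fun t ht => if_neg (not_lt.2 ht))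
    have h1 := r.gap_le_of_rhoOne hface hP hconv hβ hsmooth hα hqg hXF hδ hsc (hC r hr) hM₁ hr
      (T := τ) (fun t _ ht => if_pos ht) τ hτ le_rfl
    refine h1.trans ?_
    have hκ := hface.kappa_pos hP hdim hα
    set B := δ ^ 2 * P.kappa F α with hB
    have hB0 : 0 < B := by positivity
    have hM0 : 0 < M₁ := by linarith [(le_max_right _ _).trans hM₁]
    rcases (hC r hr).eq_or_lt with hC0 | hC0
    · rw [← hC0, zero_mul]
      exact hB0.le
    · have h2 : Real.log (C / B) ≤ ((τ : ℝ) - 1) / (4 * M₁) := by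
        rw [le_div_iff₀ (by positivity)]
        linarith
      rw [Real.log_le_iff_le_exp (by positivity), div_le_iff₀ hB0] at h2
      rw [neg_div, Real.exp_neg, ← div_eq_mul_inv, div_le_iff₀ (Real.exp_pos _), mul_comm B]
      exact h2
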